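/- Let $\Gamma=SL_2(\mathbb Z)$, $T=\begin{pmatrix}1&1\\0&1\end{pmatrix}$, and let $\rho:\Gamma\to GL_d(\mathbb C)$ ($d\ge1$) be an irreducible representation of finite level $N$ (the order of $\rho(T)$), with $$\rho(T)=\mathrm{diag}\left(e^{2\pi iA_1/N},\dots,e^{2\pi iA_d/N}\right),\qquad A_j\in\mathbb Z,\quad 0\le A_j<N .$$ For $k\in\mathbb Z$ let $\mathcal H(k,\rho)$ be the space of holomorphic $F=(f_1,\dots,f_d)^t:\mathbb H\to\mathbb C^d$ with $F|_k\gamma=\rho(\gamma)F$ for all $\gamma\in\Gamma$ that are of moderate growth at infinity (for some integer $n$, $|f_j(x+iy)|<y^{n}$ for all $j$ and all large $y$, locally uniformly in $x$), and let $\mathcal H(\rho)=\bigoplus_{k\in\mathbb Z}\mathcal H(k,\rho)$. Each $F\in\mathcal H(\rho)$ has an expansion $f_j=\sum_{n\ge0}a_j(n)q^{A_j/N+n}$, $q=e^{2\pi i\tau}$. Let $\mathcal M$ be the graded ring of modular forms for $\Gamma$, let $D$ be the operator that acts on weight $k$ as $D_kf=\frac1{2\pi i}\frac{df}{d\tau}-\frac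 k{12}E_2f$ (where $E_2=1-24\sum_{n\ge1}\sum_{m\mid n}m\,q^n$), and let $\mathcal R=\mathcal M[\partial]$ be the skew polynomial ring with $\partial M=M\partial+DM$ ($M\in\mathcal M$), which acts on $\mathcal H(\rho)$ with $\partial$ acting as $D$. Suppose that $\mathcal H(\rho)=\mathcal RF_0$ is a cyclic $\mathcal R$-module, generated by some $F_0\in\mathcal H(k_0,\rho)$ whose first component is $q^{A_1/N}+\sum_{n\ge1}a(n)q^{A_1/N+n}$ with $a(n)\in\mathbb Q$, and that there are a prime $p$ and an integer $\delta<0$ such that $$\nu_p(a(n))=n\delta-\nu_p\left(\prod_{k=1}^nk\lambda(k)\right)\quad\text{for all }n\ge1,\qquad \lambda(k)=\prod_{j=2}^d\left(Nk+A_1-A_j\right),$$ where $\nu_p$ is the $p$-adic valuation; for $d=3$ and $(A_1,A_2,A_3)=(A,B,C)$ this reads $\lambda(k)=Nk[Nk+(A-B)+(A-C)]+(A-B)(A-C)$. Call an $F\in\mathcal H(\rho)$ whose Fourier coefficients are all rational $p$-UBD if $p$ occurs to an arbitrarily high power in the denominators of the Fourier coefficients of some component of $F$, and let $\mathcal B_p$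 be the set of those $F\in\mathcal H(\rho)$ with rational Fourier coefficients that are not $p$-UBD. Then $\mathcal B_p=\{0\}$; that is, every nonzero $F\in\mathcal H(\rho)$ with rational Fourier coefficients is $p$-UBD. -/

import Mathlib

open UpperHalfPlane
open scoped MatrixGroups ModularForm Manifold

noncomputable section

namespace VVMF

/-- The representation of the modular group on column vectors given by a matrix representation. -/
def toRepresentation {d : ℕ} (ρ : SL(2, ℤ) →* GL (Fin d) ℂ) :
    Representation ℂ SL(2, ℤ) (Fin d → ℂ) :=
  ((Matrix.toLinAlgEquiv' (R := ℂ) (n := Fin d)) :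
      Matrix (Fin d) (Fin d) ℂ →* Module.End ℂ (Fin d → ℂ)).comp
    ((Units.coeHom (Matrix (Fin d) (Fin d) ℂ)).comp ρ)

/-- Moderate growth at infinity: some power of `y` dominates every component of `F (x + iy)` for
large `y`, locally uniformly in `x`. -/
def ModerateGrowth {d : ℕ} (F : ℍ → Fin d → ℂ) : Prop :=
  ∃ N : ℕ, ∀ i : Fin d, ∀ R : ℝ, ∃ Y : ℝ, ∀ τ : ℍ,
    |τ.re| ≤ R → Y ≤ τ.im → ‖F τ i‖ < τ.im ^ N

/-- `F` is a vector-valued modular form of weight `k` for `ρ`: it is holomorphic, of moderate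
growth at infinity, and satisfies `F|_k γ = ρ(γ) F` for all `γ` in `SL(2, ℤ)`. -/
structure IsVVMF {d : ℕ} (ρ : SL(2, ℤ) →* GL (Fin d) ℂ) (k : ℤ) (F : ℍ → Fin d → ℂ) : Prop where
  holo : ∀ i, MDiff (fun τ : ℍ ↦ F τ i)
  growth : ModerateGrowth F
  slash : ∀ (γ : SL(2, ℤ)) (i : Fin d),
    (fun τ : ℍ ↦ F τ i) ∣[k] γ =
      fun τ : ℍ ↦ ((ρ γ : Matrix (Fin d) (Fin d) ℂ).mulVec (F τ)) i

/-- The space `𝓗(k, ρ)` of vector-valued modular forms of weight `k` for `ρ`. -/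
def formSpace {d : ℕ} (ρ : SL(2, ℤ) →* GL (Fin d) ℂ) (k : ℤ) :
    Submodule ℂ (ℍ → Fin d → ℂ) where
  carrier := {F | IsVVMF ρ k F}
  zero_mem' := by
    refine ⟨fun i ↦ mdifferentiable_const, ⟨0, fun i R ↦ ⟨0, fun τ _ _ ↦ ?_⟩⟩, fun γ i ↦ ?_⟩
    · simp
    · ext τ
      simp [ModularForm.SL_slash_apply]
  add_mem' := by
    rintro F G ⟨hF, ⟨NF, gF⟩, sF⟩ ⟨hG, ⟨NG, gG⟩, sG⟩
    refine ⟨fun i ↦ (hF i).add (hG i), ⟨max NF NG + 1, fun i R ↦ ?_⟩, fun γ i ↦ ?_⟩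
    · obtain ⟨YF, hYF⟩ := gF i R
      obtain ⟨YG, hYG⟩ := gG i R
      refine ⟨max 2 (max YF YG), fun τ hre him ↦ ?_⟩
      have h2 : (2 : ℝ) ≤ τ.im := (le_max_left _ _).trans him
      have h1 : (1 : ℝ) ≤ τ.im := by linarith
      have hf := hYF τ hre (((le_max_left _ _).trans (le_max_right _ _)).trans him)
      have hg := hYG τ hre (((le_max_right _ _).trans (le_max_right _ _)).trans him)
      have hf' := hf.trans_le (pow_le_pow_right₀ h1 (le_max_left NF NG))
      have hg' := hg.trans_le (pow_le_pow_right₀ h1 (le_max_right NF NG))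
      have hpos : 0 < τ.im ^ max NF NG := by positivity
      calc ‖(F + G) τ i‖ ≤ ‖F τ i‖ + ‖G τ i‖ := norm_add_le _ _
        _ < τ.im ^ max NF NG * 2 := by linarith
        _ ≤ τ.im ^ max NF NG * τ.im := by gcongr
        _ = τ.im ^ (max NF NG + 1) := (pow_succ _ _).symm
    · ext τ
      have h1 := congrFun (sF γ i) τ
      have h2 := congrFun (sG γ i) τ
      simp only [ModularForm.SL_slash_apply] at h1 h2 ⊢
      simp only [Pi.add_apply, Matrix.mulVec_add, add_mul]
      rw [h1, h2]
  smul_mem' := by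
    rintro c F ⟨hF, ⟨NF, gF⟩, sF⟩
    refine ⟨fun i ↦ (hF i).const_smul c, ⟨NF + 1, fun i R ↦ ?_⟩, fun γ i ↦ ?_⟩
    · obtain ⟨YF, hYF⟩ := gF i R
      refine ⟨max (‖c‖ + 1) YF, fun τ hre him ↦ ?_⟩
      have hc : ‖c‖ < τ.im := by
        have := (le_max_left _ _).trans him
        linarith
      have hf := hYF τ hre ((le_max_right _ _).trans him)
      have hpos : 0 < τ.im ^ NF := pow_pos τ.im_pos _
      calc ‖(c • F) τ i‖ = ‖c‖ * ‖F τ i‖ := norm_mul _ _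
        _ ≤ ‖c‖ * τ.im ^ NF := by gcongr
        _ < τ.im * τ.im ^ NF := by gcongr
        _ = τ.im ^ (NF + 1) := by ring
    · ext τ
      have h1 := congrFun (sF γ i) τ
      simp only [ModularForm.SL_slash_apply] at h1 ⊢
      simp only [Pi.smul_apply, Matrix.mulVec_smul, smul_eq_mul, mul_assoc]
      rw [h1]

/-- The space `𝓗(ρ)` of vector-valued modular forms of all integral weights: the finite sums of
elements of the spaces `𝓗(k, ρ)`. -/
def formModule {d : ℕ} (ρ : SL(2, ℤ) →* GL (Fin d) ℂ) : Submodule ℂ (ℍ → Fin d → ℂ) :=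
  ⨆ k : ℤ, formSpace ρ k

/-- The iterated modular derivative `D_k^n = D_{k+2(n-1)} ∘ ⋯ ∘ D_k`, acting componentwise, where
`D_k f = (2πi)⁻¹ df/dτ - (k/12) E₂ f`. -/
def modularDeriv {d : ℕ} (k : ℤ) : ℕ → (ℍ → Fin d → ℂ) → ℍ → Fin d → ℂ
  | 0, F => F
  | n + 1, F => fun τ i ↦
      Derivative.serreDerivative ((k : ℂ) + 2 * (n : ℂ)) (fun z ↦ modularDeriv k n F z i) τ

/-- The submodule `𝓡 F` generated by a vector `F` of weight `k` over the skew polynomial ring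
`𝓡 = 𝓜[∂]`, in which `𝓜`, the graded ring of modular forms for `SL(2, ℤ)`, acts by multiplication
and `∂ʲ` by the `j`-th power of the modular derivative: the finite sums of the `g · D_k^j F`. -/
def cyclicModule {d : ℕ} (k : ℤ) (F : ℍ → Fin d → ℂ) : Submodule ℂ (ℍ → Fin d → ℂ) :=
  Submodule.span ℂ {G | ∃ (j : ℕ) (w : ℤ) (g : ModularForm 𝒮ℒ w),
    G = fun τ ↦ g τ • modularDeriv k j F τ}

/-- `f(τ) = ∑_{n ≥ 0} a(n) q^{r + n}` on the upper half-plane, where `q^s = e^{2πisτ}`. -/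
def HasQSeries (r : ℝ) (f : ℍ → ℂ) (a : ℕ → ℂ) : Prop :=
  ∀ τ : ℍ, HasSum
    (fun n : ℕ ↦ a n * Complex.exp (2 * Real.pi * Complex.I * ((r : ℂ) + n) * (τ : ℂ))) (f τ)

/-- The `i`-th component of `F` is `∑_{n ≥ 0} a_i(n) q^{r_i + n}` with rational `a_i(n)`. -/
def HasRationalQSeries {d : ℕ} (r : Fin d → ℝ) (F : ℍ → Fin d → ℂ) (a : Fin d → ℕ → ℚ) : Prop :=
  ∀ i, HasQSeries (r i) (fun τ ↦ F τ i) (fun n ↦ (a i n : ℂ))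

/-- `𝓗(ρ)_ℚ`: the elements of `𝓗(ρ)` with rational Fourier coefficients, where `r` is the vector
of exponents of `ρ(T)`. -/
def rationalForms {d : ℕ} (ρ : SL(2, ℤ) →* GL (Fin d) ℂ) (r : Fin d → ℝ) :
    Set (ℍ → Fin d → ℂ) :=
  {F | F ∈ formModule ρ ∧ ∃ a : Fin d → ℕ → ℚ, HasRationalQSeries r F a}

/-- `F` has rational Fourier coefficients and is `p`-UBD: `p` occurs to an arbitrarily high power
in the denominators of the Fourier coefficients of some component of `F`. -/
def IsPUBD {d : ℕ} (p : ℕ) (r : Fin d → ℝ) (F : ℍ → Fin d → ℂ) : Prop :=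
  ∃ a : Fin d → ℕ → ℚ, HasRationalQSeries r F a ∧
    ∃ i, ∀ m : ℕ, ∃ n : ℕ, p ^ m ∣ (a i n).den

/-- `𝓑_p`: the `p`-bounded vectors in `𝓗(ρ)_ℚ`, that is, those which are not `p`-UBD. -/
def pBoundedForms {d : ℕ} (ρ : SL(2, ℤ) →* GL (Fin d) ℂ) (p : ℕ) (r : Fin d → ℝ) :
    Set (ℍ → Fin d → ℂ) :=
  {F | F ∈ rationalForms ρ r ∧ ¬ IsPUBD p r F}

/-- The integers `λ(n) = ∏_{i > 0} (N n + A₀ - Aᵢ)`. For three exponents `A/N, B/N, C/N` this is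
`λ(n) = N n (N n + (A - B) + (A - C)) + (A - B) (A - C)`. -/
def lam {d : ℕ} [NeZero d] (N : ℕ) (A : Fin d → ℕ) (n : ℕ) : ℤ :=
  ∏ i ∈ Finset.univ.erase (0 : Fin d), ((N : ℤ) * n + A 0 - A i)

end VVMF

end

/-!
Let `F ≠ 0` have rational coefficients. As `ρ` is irreducible of finite level, the components of
`F` are linearly independent, so some derivatives of `F` form a basis of `ℂᵈ` at a given point.
Expressing `F₀` in them by Cramer's rule, and multiplying by the eleventh power of the determinant,
one finds a relation `Q F₀ = ∑ Rₜ Dⁿ⁽ᵗ⁾ F`, where `Q ≠ 0` and the `Rₜ` are polynomials in `E₂` and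
level one modular forms. The coefficients of their `q`-series lie in finitely generated subgroups
of `ℂ`, so their images under a `ℚ`-linear map `ℂ → ℚ_p` are bounded. If `F` were `p`-bounded, then
a nonzero `p`-bounded series times `∑ a(n) qⁿ` would be `p`-bounded. This is impossible: the
valuations of the `a(n)` never increase, and drop by at least `t` from `n = p ^ t - 1` to
`n = p ^ t`, so the coefficients `a(p ^ t)` dominate all the earlier ones.
-/

noncomputable section

namespace VVMF

open Derivative PowerSeries

section QSeries

variable {r s : ℝ} {f g : ℍ → ℂ} {P Q : ℂ⟦X⟧}

lemma hasQSeries_zero_iff {a : ℕ → ℂ} :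
    HasQSeries 0 f a ↔ ∀ τ : ℍ, HasSum (fun n ↦ a n • Function.Periodic.qParam 1 τ ^ n) (f τ) := by
  refine forall_congr' fun τ ↦ iff_of_eq (congrArg (HasSum · (f τ)) (funext fun n ↦ ?_))
  rw [Function.Periodic.qParam, ← Complex.exp_nat_mul, smul_eq_mul]
  congr 2
  push_cast
  ring

lemma HasQSeries.mul_cexp {a : ℕ → ℂ} (hf : HasQSeries r f a) (s : ℝ) :
    HasQSeries (r + s) (fun τ ↦ f τ * Complex.exp (2 * Real.pi * Complex.I * s * (τ : ℂ))) a := by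
  intro τ
  convert! (hf τ).mul_right (Complex.exp (2 * Real.pi * Complex.I * s * (τ : ℂ))) using 2 with n
  rw [mul_assoc (a n), ← Complex.exp_add]
  congr 2
  push_cast
  ring

lemma HasQSeries.add (hf : HasQSeries r f (P.coeff ·)) (hg : HasQSeries r g (Q.coeff ·)) :
    HasQSeries r (f + g) ((P + Q).coeff ·) := fun τ ↦ by
  simpa only [map_add, add_mul] using! (hf τ).add (hg τ)

lemma HasQSeries.sub (hf : HasQSeries r f (P.coeff ·)) (hg : HasQSeries r g (Q.coeff ·)) :
    HasQSeries r (f - g) ((P - Q).coeff ·) := fun τ ↦ by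
  simpa only [map_sub, sub_mul] using! (hf τ).sub (hg τ)

lemma HasQSeries.sum {ι : Type*} {t : Finset ι} {f : ι → ℍ → ℂ} {P : ι → ℂ⟦X⟧}
    (h : ∀ i ∈ t, HasQSeries r (f i) ((P i).coeff ·)) :
    HasQSeries r (∑ i ∈ t, f i) ((∑ i ∈ t, P i).coeff ·) := fun τ ↦ by
  simpa only [map_sum, Finset.sum_mul, Finset.sum_apply] using hasSum_sum fun i hi ↦ h i hi τ

lemma HasQSeries.mul (hf : HasQSeries r f (P.coeff ·)) (hg : HasQSeries s g (Q.coeff ·)) :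
    HasQSeries (r + s) (f * g) ((P * Q).coeff ·) := by
  intro τ
  have hfs := (hf τ).summable.norm
  have hgs := (hg τ).summable.norm
  have h := (summable_norm_sum_mul_antidiagonal_of_summable_norm hfs hgs).of_norm.hasSum
  rw [← tsum_mul_tsum_eq_tsum_sum_antidiagonal_of_summable_norm hfs hgs, (hf τ).tsum_eq,
    (hg τ).tsum_eq] at h
  convert! h using 2 with n
  dsimp only
  rw [coeff_mul, Finset.sum_mul]
  refine Finset.sum_congr rfl fun ⟨i, j⟩ hij ↦ ?_
  obtain rfl : i + j = n := by simpa using hij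
  rw [mul_mul_mul_comm, ← Complex.exp_add]
  congr 2
  push_cast
  ring

lemma hasQSeries_algebraMap (c : ℂ) :
    HasQSeries 0 (algebraMap ℂ (ℍ → ℂ) c) ((algebraMap ℂ ℂ⟦X⟧ c).coeff ·) :=
  hasQSeries_zero_iff.mpr fun τ ↦ by
    simpa using hasSum_single (f := fun n ↦ (algebraMap ℂ ℂ⟦X⟧ c).coeff n •
      Function.Periodic.qParam 1 τ ^ n) 0 (fun n hn ↦ by simp [coeff_C, hn])

lemma HasQSeries.eq_zero (h : HasQSeries r 0 (P.coeff ·)) : P = 0 := by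
  have h₀ : HasQSeries 0 (⇑(0 : ModularForm 𝒮ℒ 0)) (P.coeff ·) := by
    simpa [add_neg_cancel, Pi.zero_def] using h.mul_cexp (-r)
  ext n
  rw [ModularFormClass.qExpansion_coeff_unique one_pos one_mem_strictPeriods_SL
    (hasQSeries_zero_iff.mp h₀) n]
  exact congrArg (coeff n) (qExpansion_zero 1)

lemma HasQSeries.unique (hP : HasQSeries r f (P.coeff ·)) (hQ : HasQSeries r f (Q.coeff ·)) :
    P = Q :=
  sub_eq_zero.mp (HasQSeries.eq_zero (by simpa only [sub_self] using hP.sub hQ))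

lemma norm_mul_cexp_two_pi_I_mul (a : ℂ) (s : ℝ) (z : ℂ) :
    ‖a * Complex.exp (2 * Real.pi * Complex.I * s * z)‖ =
      ‖a‖ * Real.exp (-(2 * Real.pi * (s * z.im))) := by
  rw [norm_mul, Complex.norm_exp]
  congr 2
  simp [Complex.mul_re, Complex.mul_im, mul_assoc]

lemma exp_neg_mul_le_add {s y₁ y y₂ : ℝ} (h₁ : y₁ ≤ y) (h₂ : y ≤ y₂) :
    Real.exp (-(2 * Real.pi * (s * y))) ≤
      Real.exp (-(2 * Real.pi * (s * y₁))) + Real.exp (-(2 * Real.pi * (s * y₂))) := by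
  rcases le_total 0 s with hs | hs
  · refine le_add_of_le_of_nonneg ?_ (Real.exp_nonneg _)
    gcongr
  · refine le_add_of_nonneg_of_le (Real.exp_nonneg _) ?_
    refine Real.exp_le_exp.mpr (neg_le_neg ?_)
    nlinarith [Real.pi_pos, mul_le_mul_of_nonpos_left h₂ hs]

/-- The operator `q^{-r} (q d/dq) q^r` on power series in `q`. -/
def twistedEuler (r : ℝ) (P : ℂ⟦X⟧) : ℂ⟦X⟧ :=
  PowerSeries.mk fun n ↦ ((r : ℂ) + n) * P.coeff n

@[simp]
lemma coeff_twistedEuler (r : ℝ) (P : ℂ⟦X⟧) (n : ℕ) :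
    (twistedEuler r P).coeff n = (r + n) * P.coeff n :=
  coeff_mk _ _

lemma HasQSeries.normalizedDeriv (hf : HasQSeries r f (P.coeff ·)) :
    HasQSeries r (D f) ((twistedEuler r P).coeff ·) := by
  intro τ
  let G (n : ℕ) (z : ℂ) : ℂ :=
    P.coeff n * Complex.exp (2 * Real.pi * Complex.I * ((r : ℂ) + n) * z)
  let τ₁ : ℍ := ⟨⟨0, τ.im / 2⟩, half_pos τ.im_pos⟩
  let τ₂ : ℍ := ⟨⟨0, 2 * τ.im⟩, mul_pos two_pos τ.im_pos⟩
  let U : Set ℂ := Complex.im ⁻¹' Set.Ioo τ₁.im τ₂.im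
  have hU : IsOpen U := isOpen_Ioo.preimage Complex.continuous_im
  have hτ : (τ : ℂ) ∈ U := ⟨half_lt_self τ.im_pos, lt_two_mul_self τ.im_pos⟩
  have hG (n : ℕ) (z : ℂ) : HasDerivAt (G n) (2 * Real.pi * Complex.I * ((r + n) * G n z)) z := by
    convert! (((hasDerivAt_id z).const_mul
      (2 * Real.pi * Complex.I * ((r : ℂ) + n))).cexp).const_mul (P.coeff n) using 1
    simp only [G, id, mul_one]
    ring
  have hle (n : ℕ) (z : ℂ) (hz : z ∈ U) : ‖G n z‖ ≤ ‖G n τ₁‖ + ‖G n τ₂‖ := by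
    have hnorm (z : ℂ) := norm_mul_cexp_two_pi_I_mul (P.coeff n) (r + n) z
    push_cast at hnorm
    simp only [G, hnorm, ← mul_add]
    gcongr
    exact exp_neg_mul_le_add hz.1.le hz.2.le
  have hderiv := Complex.hasSum_deriv_of_summable_norm
    ((hf τ₁).summable.norm.add (hf τ₂).summable.norm)
    (fun n z _ ↦ (hG n z).differentiableAt.differentiableWithinAt) hU hle hτ
  have hfeq : Set.EqOn (fun z ↦ ∑' n, G n z) (f ∘ ofComplex) U := fun z hz ↦ by
    have hz₀ : 0 < z.im := τ₁.im_pos.trans hz.1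
    rw [Function.comp_apply, ofComplex_apply_of_im_pos hz₀]
    exact (hf ⟨z, hz₀⟩).tsum_eq
  rw [(hfeq.eventuallyEq_of_mem (hU.mem_nhds hτ)).deriv_eq] at hderiv
  convert! hderiv.mul_left (2 * Real.pi * Complex.I)⁻¹ using 2 with n
  dsimp only
  rw [(hG n τ).deriv, inv_mul_cancel_left₀ Complex.two_pi_I_ne_zero, coeff_twistedEuler, mul_assoc]

end QSeries


section IntegralQSeries

/-- The power series whose coefficients span a finitely generated additive group: up to finitely
many complex constants, their coefficients are integers. -/
def fgCoeffSeries (R : Type*) [CommRing R] : Subalgebra R R⟦X⟧ where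
  carrier := {P | ∃ L : Submodule ℤ R, L.FG ∧ ∀ n, P.coeff n ∈ L}
  mul_mem' := by
    rintro P Q ⟨L, hL, hP⟩ ⟨M, hM, hQ⟩
    refine ⟨L * M, hL.mul hM, fun n ↦ ?_⟩
    rw [coeff_mul]
    exact sum_mem fun i _ ↦ Submodule.mul_mem_mul (hP _) (hQ _)
  add_mem' := by
    rintro P Q ⟨L, hL, hP⟩ ⟨M, hM, hQ⟩
    exact ⟨L ⊔ M, hL.sup hM, fun n ↦ Submodule.add_mem_sup (hP n) (hQ n)⟩
  algebraMap_mem' c := by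
    refine ⟨ℤ ∙ c, Submodule.fg_span_singleton c, fun n ↦ ?_⟩
    rw [PowerSeries.algebraMap_apply, Algebra.algebraMap_self, RingHom.id_apply, coeff_C]
    split_ifs
    exacts [Submodule.mem_span_singleton_self c, zero_mem _]

lemma mem_fgCoeffSeries_of_forall_eq_intCast {R : Type*} [CommRing R] {P : R⟦X⟧}
    (h : ∀ n, ∃ z : ℤ, P.coeff n = z) : P ∈ fgCoeffSeries R := by
  refine ⟨ℤ ∙ (1 : R), Submodule.fg_span_singleton 1, fun n ↦ ?_⟩
  obtain ⟨z, hz⟩ := h n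
  exact Submodule.mem_span_singleton.mpr ⟨z, by rw [hz, zsmul_one]⟩

lemma twistedEuler_zero_mem_fgCoeffSeries {P : ℂ⟦X⟧} (hP : P ∈ fgCoeffSeries ℂ) :
    twistedEuler 0 P ∈ fgCoeffSeries ℂ := by
  obtain ⟨L, hL, hP⟩ := hP
  refine ⟨L, hL, fun n ↦ ?_⟩
  simpa using L.smul_mem (n : ℤ) (hP n)

/-- The holomorphic functions on the upper half-plane with a `q`-series in `fgCoeffSeries ℂ`. -/
def qAlg : Subalgebra ℂ (ℍ → ℂ) where
  carrier := {f | MDiff f ∧ ∃ P ∈ fgCoeffSeries ℂ, HasQSeries 0 f (P.coeff ·)}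
  mul_mem' := by
    rintro f g ⟨hf, P, hP, hfP⟩ ⟨hg, Q, hQ, hgQ⟩
    exact ⟨hf.mul hg, P * Q, mul_mem hP hQ, by simpa only [add_zero] using hfP.mul hgQ⟩
  add_mem' := by
    rintro f g ⟨hf, P, hP, hfP⟩ ⟨hg, Q, hQ, hgQ⟩
    exact ⟨hf.add hg, P + Q, add_mem hP hQ, hfP.add hgQ⟩
  algebraMap_mem' c :=
    ⟨mdifferentiable_const, _, (fgCoeffSeries ℂ).algebraMap_mem c, hasQSeries_algebraMap c⟩

lemma normalizedDeriv_mem_qAlg {f : ℍ → ℂ} (hf : f ∈ qAlg) : D f ∈ qAlg := by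
  obtain ⟨hf, P, hP, hfP⟩ := hf
  exact ⟨normalizedDerivOfComplex_mdifferentiable hf, _, twistedEuler_zero_mem_fgCoeffSeries hP,
    hfP.normalizedDeriv⟩

lemma E2_mem_qAlg : EisensteinSeries.E2 ∈ qAlg := by
  let c (n : ℕ) : ℤ := if n = 0 then 1 else -24 * (ArithmeticFunction.sigma 1 n : ℕ)
  refine ⟨E2_mdifferentiable, PowerSeries.mk fun n ↦ (c n : ℂ),
    mem_fgCoeffSeries_of_forall_eq_intCast fun n ↦ ⟨c n, coeff_mk _ _⟩,
    hasQSeries_zero_iff.mpr fun τ ↦ ?_⟩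
  convert! EisensteinSeries.hasSum_qExpansion_E2 (z := τ) using 2 with n
  by_cases h : n = 0 <;> simp [c, h, Function.Periodic.qParam]

lemma E_mem_qAlg {k : ℕ} (hk : 3 ≤ k) (hk₂ : Even k) : (ModularForm.E hk : ℍ → ℂ) ∈ qAlg := by
  refine ⟨ModularFormClass.holo _, qExpansion 1 (ModularForm.E hk), ?_, hasQSeries_zero_iff.mpr
    (ModularForm.hasSum_qExpansion _ one_pos one_mem_strictPeriods_SL)⟩
  let S : ℂ⟦X⟧ := PowerSeries.mk fun n ↦
    if n = 0 then 0 else (ArithmeticFunction.sigma (k - 1) n : ℂ)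
  have hS : S ∈ fgCoeffSeries ℂ := mem_fgCoeffSeries_of_forall_eq_intCast fun n ↦
    ⟨if n = 0 then 0 else (ArithmeticFunction.sigma (k - 1) n : ℕ), by simp [S]⟩
  have hE : qExpansion 1 (ModularForm.E hk) = 1 + (-(2 * k / bernoulli k : ℂ)) • S := by
    ext n
    rw [EisensteinSeries.E_qExpansion_coeff hk hk₂]
    by_cases h : n = 0 <;> simp [S, h, coeff_one]
  rw [hE]
  exact add_mem (one_mem _) (Subalgebra.smul_mem _ hS _)

lemma exists_eq_discriminant_mul_add_smul_E {k : ℕ} (hk : 3 ≤ k) (hk₂ : Even k)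
    (f : ModularForm 𝒮ℒ k) : ∃ (g : ModularForm 𝒮ℒ ((k : ℤ) - 12)) (c : ℂ),
      (f : ℍ → ℂ) = ModularForm.discriminant * g + c • (ModularForm.E hk : ℍ → ℂ) := by
  set c := (qExpansion 1 f).coeff 0
  have hcusp : (qExpansion 1 (f - c • ModularForm.E hk : ModularForm 𝒮ℒ k)).coeff 0 = 0 := by
    rw [FunLike.coe_sub, ModularForm.qExpansion_sub one_pos one_mem_strictPeriods_SL,
      FunLike.coe_smul, ModularForm.qExpansion_smul one_pos one_mem_strictPeriods_SL, map_sub,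
      PowerSeries.coeff_smul, EisensteinSeries.E_qExpansion_coeff_zero hk hk₂, smul_eq_mul,
      mul_one, sub_self]
  refine ⟨CuspForm.discriminantEquiv (ModularForm.toCuspForm _ hcusp), c, ?_⟩
  rw [ModularForm.discriminant_mul_discriminantEquiv]
  ext z
  simp

lemma modularForm_mem_of_forall_E_mem {S : Subalgebra ℂ (ℍ → ℂ)}
    (hS : ∀ {k : ℕ} (hk : 3 ≤ k), Even k → (ModularForm.E hk : ℍ → ℂ) ∈ S) {k : ℤ}
    (f : ModularForm 𝒮ℒ k) : (f : ℍ → ℂ) ∈ S := by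
  have hΔ : ModularForm.discriminant ∈ S := by
    have : ModularForm.discriminant = (1728 : ℂ)⁻¹ •
        ((ModularForm.E₄ : ℍ → ℂ) ^ 3 - (ModularForm.E₆ : ℍ → ℂ) ^ 2) := by
      ext z
      simp [ModularForm.discriminant_eq_E₄_cube_sub_E₆_sq, div_eq_inv_mul]
    rw [this]
    exact S.smul_mem (sub_mem (pow_mem (hS _ ⟨2, rfl⟩) _) (pow_mem (hS _ ⟨3, rfl⟩) _)) _
  rcases lt_or_ge k 0 with hk | hk
  · exact ModularFormClass.levelOne_neg_weight_eq_zero hk f ▸ zero_mem S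
  lift k to ℕ using hk
  induction k using Nat.strong_induction_on with | _ k ih =>
  rcases Nat.even_or_odd k with hk₂ | hodd
  swap
  · exact ModularForm.levelOne_odd_weight_eq_zero (mod_cast hodd) f ▸ zero_mem S
  rcases lt_or_ge k 3 with hk₃ | hk₃
  · interval_cases k
    · obtain ⟨c, hc⟩ := ModularFormClass.levelOne_weight_zero_const f
      exact hc ▸ S.algebraMap_mem c
    · exact absurd hk₂ (by decide)
    · exact rank_zero_iff_forall_zero.mp ModularForm.levelOne_weight_two_rank_zero f ▸ zero_mem S
  obtain ⟨g, c, hfg⟩ := exists_eq_discriminant_mul_add_smul_E hk₃ hk₂ f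
  rw [hfg]
  refine add_mem (mul_mem hΔ ?_) (S.smul_mem (hS hk₃ hk₂) c)
  rcases lt_or_ge k 12 with hk₁₂ | hk₁₂
  · exact ModularFormClass.levelOne_neg_weight_eq_zero (by lia) g ▸ zero_mem S
  · exact ih (k - 12) (by lia) (ModularForm.mcast (by lia) g)

lemma modularForm_mem_qAlg {k : ℤ} (f : ModularForm 𝒮ℒ k) : (f : ℍ → ℂ) ∈ qAlg :=
  modularForm_mem_of_forall_E_mem E_mem_qAlg f

end IntegralQSeries


section ModerateGrowth

open Filter Asymptotics

/-- The filter of approach to `i∞` inside the vertical strip `|Re τ| ≤ R`. -/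
def stripAtImInfty (R : ℝ) : Filter ℍ := atImInfty ⊓ 𝓟 {τ | |τ.re| ≤ R}

lemma eventually_stripAtImInfty {R : ℝ} {p : ℍ → Prop} :
    (∀ᶠ τ in stripAtImInfty R, p τ) ↔ ∃ Y : ℝ, ∀ τ : ℍ, |τ.re| ≤ R → Y ≤ τ.im → p τ := by
  rw [stripAtImInfty, eventually_inf_principal, Filter.Eventually, atImInfty_mem]
  exact exists_congr fun Y ↦ forall_congr' fun τ ↦ forall_comm

lemma isBigO_im_pow_of_le {l : Filter ℍ} (hl : l ≤ atImInfty) {m n : ℕ} (hmn : m ≤ n) :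
    (fun τ : ℍ ↦ τ.im ^ m) =O[l] fun τ : ℍ ↦ τ.im ^ n := by
  refine .of_bound 1 (hl ((atImInfty_mem _).mpr ⟨1, fun τ hτ ↦ ?_⟩))
  rw [Set.mem_ofPred_eq, one_mul, norm_pow, norm_pow, Real.norm_of_nonneg τ.im_pos.le]
  exact pow_le_pow_right₀ hτ hmn

/-- Polynomial growth in `Im τ` at `i∞`, with an exponent that does not depend on the strip. -/
def HasModerateGrowth (g : ℍ → ℂ) : Prop :=
  ∃ n : ℕ, ∀ R : ℝ, g =O[stripAtImInfty R] fun τ ↦ τ.im ^ n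

lemma hasModerateGrowth_of_isBoundedAtImInfty {g : ℍ → ℂ} (hg : IsBoundedAtImInfty g) :
    HasModerateGrowth g :=
  ⟨0, fun R ↦ by simpa only [pow_zero] using! hg.mono inf_le_left⟩

lemma HasModerateGrowth.add {f g : ℍ → ℂ} (hf : HasModerateGrowth f) (hg : HasModerateGrowth g) :
    HasModerateGrowth (f + g) := by
  obtain ⟨m, hm⟩ := hf
  obtain ⟨n, hn⟩ := hg
  exact ⟨max m n, fun R ↦ .add ((hm R).trans (isBigO_im_pow_of_le inf_le_left (le_max_left m n)))
    ((hn R).trans (isBigO_im_pow_of_le inf_le_left (le_max_right m n)))⟩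

lemma HasModerateGrowth.mul {f g : ℍ → ℂ} (hf : HasModerateGrowth f) (hg : HasModerateGrowth g) :
    HasModerateGrowth (f * g) := by
  obtain ⟨m, hm⟩ := hf
  obtain ⟨n, hn⟩ := hg
  exact ⟨m + n, fun R ↦ by simpa only [pow_add] using! (hm R).mul (hn R)⟩

lemma im_mem_Icc_of_mem_closedBall {τ : ℍ} {z : ℂ} (hz : z ∈ Metric.closedBall (τ : ℂ) 1) :
    z.im ∈ Set.Icc (τ.im - 1) (τ.im + 1) := by
  have := abs_le.mp ((Complex.abs_im_le_norm (z - τ)).trans (mem_closedBall_iff_norm.mp hz))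
  rw [Complex.sub_im, coe_im] at this
  constructor <;> linarith

lemma abs_re_le_of_mem_closedBall {τ : ℍ} {z : ℂ} (hz : z ∈ Metric.closedBall (τ : ℂ) 1) :
    |z.re| ≤ |τ.re| + 1 := by
  have := (Complex.abs_re_le_norm (z - τ)).trans (mem_closedBall_iff_norm.mp hz)
  rw [Complex.sub_re, coe_re] at this
  linarith [abs_sub_abs_le_abs_sub z.re τ.re]

lemma norm_normalizedDeriv_le {g : ℍ → ℂ} (hg : MDiff g) {τ : ℍ} (hτ : 1 < τ.im) {B : ℝ}
    (hB : ∀ z : ℍ, (z : ℂ) ∈ Metric.closedBall (τ : ℂ) 1 → ‖g z‖ ≤ B) :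
    ‖D g τ‖ ≤ ‖(2 * Real.pi * Complex.I : ℂ)⁻¹‖ * B := by
  have him {z : ℂ} (hz : z ∈ Metric.closedBall (τ : ℂ) 1) : 0 < z.im :=
    (sub_pos.mpr hτ).trans_le (im_mem_Icc_of_mem_closedBall hz).1
  have hdiff : DifferentiableOn ℂ (g ∘ ofComplex) (Metric.closedBall τ 1) :=
    (UpperHalfPlane.mdifferentiable_iff.mp hg).mono fun z hz ↦ him hz
  have hderiv := Complex.norm_deriv_le_of_forall_mem_sphere_norm_le one_pos
    (hdiff.diffContOnCl_ball subset_rfl) fun z hz ↦ by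
      have hz' := Metric.sphere_subset_closedBall hz
      rw [Function.comp_apply, ofComplex_apply_of_im_pos (him hz')]
      exact hB ⟨z, him hz'⟩ hz'
  rw [div_one] at hderiv
  rw [normalizedDerivOfComplex, norm_mul]
  gcongr

lemma HasModerateGrowth.normalizedDeriv {g : ℍ → ℂ} (hg : HasModerateGrowth g) (hg' : MDiff g) :
    HasModerateGrowth (D g) := by
  obtain ⟨n, hn⟩ := hg
  refine ⟨n, fun R ↦ ?_⟩
  obtain ⟨C, hC₀, hC⟩ := (hn (R + 1)).exists_nonneg
  obtain ⟨Y, hY⟩ := eventually_stripAtImInfty.mp hC.bound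
  refine .of_bound (‖(2 * Real.pi * Complex.I : ℂ)⁻¹‖ * (C * 2 ^ n))
    (eventually_stripAtImInfty.mpr ⟨max 2 (Y + 1), fun τ hre him ↦ ?_⟩)
  have him₂ : 2 ≤ τ.im := (le_max_left _ _).trans him
  have himY : Y + 1 ≤ τ.im := (le_max_right _ _).trans him
  have hbound := norm_normalizedDeriv_le hg' (by linarith) (B := C * (2 * τ.im) ^ n) fun z hz ↦ by
    have him_z : τ.im - 1 ≤ z.im ∧ z.im ≤ τ.im + 1 := im_mem_Icc_of_mem_closedBall hz
    have hre_z : |z.re| ≤ |τ.re| + 1 := abs_re_le_of_mem_closedBall hz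
    refine (hY z (by linarith) (by linarith)).trans ?_
    rw [norm_pow, Real.norm_of_nonneg z.im_pos.le]
    gcongr
    linarith
  rwa [norm_pow, Real.norm_of_nonneg τ.im_pos.le, mul_assoc _ _ (τ.im ^ n), mul_assoc C,
    ← mul_pow]

/-- The holomorphic functions on the upper half-plane of moderate growth. -/
def moderateAlg : Subalgebra ℂ (ℍ → ℂ) where
  carrier := {g | MDiff g ∧ HasModerateGrowth g}
  mul_mem' hf hg := ⟨hf.1.mul hg.1, hf.2.mul hg.2⟩
  add_mem' hf hg := ⟨hf.1.add hg.1, hf.2.add hg.2⟩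
  algebraMap_mem' c := ⟨mdifferentiable_const,
    hasModerateGrowth_of_isBoundedAtImInfty (Filter.const_boundedAtFilter _ c)⟩

lemma E2_mem_moderateAlg : EisensteinSeries.E2 ∈ moderateAlg :=
  ⟨E2_mdifferentiable,
    hasModerateGrowth_of_isBoundedAtImInfty EisensteinSeries.isBoundedAtImInfty_E2⟩

lemma serreDerivative_mem_moderateAlg (k : ℂ) {g : ℍ → ℂ} (hg : g ∈ moderateAlg) :
    serreDerivative k g ∈ moderateAlg := by
  have h : serreDerivative k g = D g - (k / 12) • (EisensteinSeries.E2 * g) := by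
    ext τ
    rw [serreDerivative_apply, Pi.sub_apply, Pi.smul_apply, Pi.mul_apply, smul_eq_mul, mul_assoc]
    ring
  rw [h]
  exact sub_mem ⟨normalizedDerivOfComplex_mdifferentiable hg.1, hg.2.normalizedDeriv hg.1⟩
    (moderateAlg.smul_mem (mul_mem E2_mem_moderateAlg hg) _)

lemma moderateGrowth_iff {d : ℕ} {F : ℍ → Fin d → ℂ} :
    ModerateGrowth F ↔ ∀ i, HasModerateGrowth fun τ ↦ F τ i := by
  constructor
  · rintro ⟨n, hn⟩ i
    refine ⟨n, fun R ↦ .of_bound 1 (eventually_stripAtImInfty.mpr ?_)⟩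
    refine (hn i R).imp fun Y hY τ hre him ↦ ?_
    simpa [abs_of_pos τ.im_pos] using (hY τ hre him).le
  · intro h
    choose n hn using h
    refine ⟨Finset.univ.sup n + 1, fun i R ↦ ?_⟩
    obtain ⟨C, hC⟩ := ((hn i R).trans
      (isBigO_im_pow_of_le inf_le_left (Finset.le_sup (Finset.mem_univ i)))).bound
    obtain ⟨Y, hY⟩ := eventually_stripAtImInfty.mp hC
    refine ⟨max (C + 1) Y, fun τ hre him ↦ (hY τ hre ((le_max_right _ _).trans him)).trans_lt ?_⟩
    rw [norm_pow, Real.norm_of_nonneg τ.im_pos.le, pow_succ']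
    gcongr
    linarith [(le_max_left _ _).trans him]

end ModerateGrowth


section CharacterForms

open Filter Asymptotics ModularGroup

lemma periodic_comp_ofComplex {g : ℍ → ℂ} (hg : ∀ τ, g ((1 : ℝ) +ᵥ τ) = g τ) :
    Function.Periodic (g ∘ ofComplex) (1 : ℝ) := by
  intro w
  rcases lt_or_ge 0 w.im with hw | hw
  · have hw₁ : 0 < (w + (1 : ℝ)).im := by simpa using hw
    rw [Function.comp_apply, Function.comp_apply, ofComplex_apply_of_im_pos hw₁,
      ofComplex_apply_of_im_pos hw, ← hg ⟨w, hw⟩]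
    congr 1
    ext
    simp [add_comm]
  · have hw₁ : (w + (1 : ℝ)).im ≤ 0 := by simpa using hw
    rw [Function.comp_apply, Function.comp_apply, ofComplex_apply_of_im_nonpos hw₁,
      ofComplex_apply_of_im_nonpos hw]

lemma HasModerateGrowth.exists_isBigO_of_periodic {g : ℍ → ℂ} (hg : HasModerateGrowth g)
    (hper : ∀ τ, g ((1 : ℝ) +ᵥ τ) = g τ) : ∃ n : ℕ, g =O[atImInfty] fun τ ↦ τ.im ^ n := by
  obtain ⟨n, hn⟩ := hg
  obtain ⟨C, hC⟩ := (hn 1).bound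
  obtain ⟨Y, hY⟩ := eventually_stripAtImInfty.mp hC
  refine ⟨n, .of_bound C ((atImInfty_mem _).mpr ⟨Y, fun τ hτ ↦ ?_⟩)⟩
  have hperiodic : Function.Periodic (fun x : ℝ ↦ g (x +ᵥ τ)) 1 := fun x ↦ by
    rw [add_comm]
    exact (congrArg g (add_vadd 1 x τ)).trans (hper _)
  have htranslate : g ((-⌊τ.re⌋ : ℝ) +ᵥ τ) = g τ := by
    simpa using hperiodic.int_mul_eq (-⌊τ.re⌋)
  have hre : |((-⌊τ.re⌋ : ℝ) +ᵥ τ).re| ≤ 1 := by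
    rw [vadd_re, abs_le]
    constructor <;> linarith [Int.floor_le τ.re, Int.lt_floor_add_one τ.re]
  simpa only [htranslate, vadd_im] using! hY _ hre (by simpa using hτ)

lemma norm_qParam_one (τ : ℍ) :
    ‖Function.Periodic.qParam 1 τ‖ = Real.exp (-(2 * Real.pi) * τ.im) := by
  simp [Function.Periodic.norm_qParam]

lemma isZeroAtImInfty_qParam_mul {g : ℍ → ℂ} {n : ℕ}
    (hg : g =O[atImInfty] fun τ ↦ τ.im ^ n) :
    IsZeroAtImInfty fun τ ↦ Function.Periodic.qParam 1 τ * g τ := by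
  have hexp : (fun τ : ℍ ↦ Function.Periodic.qParam 1 τ) =O[atImInfty]
      fun τ ↦ Real.exp (-(2 * Real.pi) * τ.im) :=
    .of_bound 1 (.of_forall fun τ ↦ by simp [norm_qParam_one])
  have hlim := tendsto_rpow_mul_exp_neg_mul_atTop_nhds_zero n _ Real.two_pi_pos
  simp only [Real.rpow_natCast, mul_comm _ (Real.exp _)] at hlim
  exact (hexp.mul hg).trans_tendsto (hlim.comp tendsto_comap)

/-- Riemann's removable singularity theorem in the variable `q`: the function `q g` vanishes at
`q = 0`, hence is `O(q)`. -/
lemma HasModerateGrowth.isBoundedAtImInfty_of_periodic {g : ℍ → ℂ} (hg : HasModerateGrowth g)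
    (hg' : MDiff g) (hper : ∀ τ, g ((1 : ℝ) +ᵥ τ) = g τ) : IsBoundedAtImInfty g := by
  obtain ⟨n, hn⟩ := hg.exists_isBigO_of_periodic hper
  have hzero := isZeroAtImInfty_qParam_mul hn
  have hqper := periodic_comp_ofComplex (g := fun τ : ℍ ↦ Function.Periodic.qParam 1 τ * g τ)
    fun τ ↦ by simp [hper, Function.Periodic.qParam, mul_add, Complex.exp_add]
  have hholo : MDiff fun τ : ℍ ↦ Function.Periodic.qParam 1 τ * g τ :=
    (Function.Periodic.differentiable_qParam.mdifferentiable.comp mdifferentiable_coe).mul hg'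
  obtain ⟨K, hK⟩ := (hzero.exp_decay_atImInfty one_pos hqper hholo hzero.isBoundedAtImInfty).bound
  refine .of_bound K (hK.mono fun τ hτ ↦ ?_)
  rw [norm_mul, norm_qParam_one, Real.norm_of_nonneg (Real.exp_nonneg _), div_one, ← neg_mul,
    mul_comm] at hτ
  simpa using le_of_mul_le_mul_right hτ (Real.exp_pos _)

/-- Functions in `moderateAlg` that transform in weight `k` under the modular group by the
character `χ`. -/
structure IsCharForm (χ : SL(2, ℤ) →* ℂ) (k : ℤ) (g : ℍ → ℂ) : Prop where
  mem : g ∈ moderateAlg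
  slash : ∀ γ : SL(2, ℤ), g ∣[k] γ = χ γ • g

lemma IsCharForm.mul {χ₁ χ₂ : SL(2, ℤ) →* ℂ} {k₁ k₂ : ℤ} {g₁ g₂ : ℍ → ℂ}
    (h₁ : IsCharForm χ₁ k₁ g₁) (h₂ : IsCharForm χ₂ k₂ g₂) :
    IsCharForm (χ₁ * χ₂) (k₁ + k₂) (g₁ * g₂) where
  mem := mul_mem h₁.mem h₂.mem
  slash γ := by
    rw [ModularForm.mul_slash_SL2, h₁.slash, h₂.slash, smul_mul_smul_comm, MonoidHom.mul_apply]

lemma IsCharForm.exists_modularForm {k : ℤ} {g : ℍ → ℂ} (h : IsCharForm 1 k g) :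
    ∃ f : ModularForm 𝒮ℒ k, ⇑f = g := by
  have hslash (γ : SL(2, ℤ)) : g ∣[k] γ = g := by
    rw [h.slash, MonoidHom.one_apply, one_smul]
  let f : SlashInvariantForm 𝒮ℒ k :=
    { toFun := g
      slash_action_eq' := by
        rintro _ ⟨γ, rfl⟩
        exact hslash γ }
  have hbdd : IsBoundedAtImInfty g := h.mem.2.isBoundedAtImInfty_of_periodic h.mem.1 fun τ ↦
    SlashInvariantForm.vAdd_apply_of_mem_strictPeriods f τ one_mem_strictPeriods_SL
  refine ⟨{ f with holo' := h.mem.1, bdd_at_cusps' := fun {c} hc ↦ ?_ }, rfl⟩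
  rw [Subgroup.IsArithmetic.isCusp_iff_isCusp_SL2Z] at hc
  refine (OnePoint.isBoundedAt_iff_forall_SL2Z hc).mpr fun γ _ ↦ ?_
  exact (hslash γ).symm ▸ hbdd

lemma IsCharForm.mem_qAlg {k : ℤ} {g : ℍ → ℂ} (h : IsCharForm 1 k g) : g ∈ qAlg := by
  obtain ⟨f, rfl⟩ := h.exists_modularForm
  exact modularForm_mem_qAlg f

lemma character_pow_twelve (χ : SL(2, ℤ) →* ℂ) : χ ^ 12 = 1 := by
  have hS4 : χ S ^ 4 = 1 := by
    rw [← map_pow, show S ^ 4 = 1 by decide, map_one]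
  have hST : (χ S * χ T) ^ 3 = χ S ^ 2 := by
    rw [← map_mul, ← map_pow, ← map_pow, show (S * T) ^ 3 = S ^ 2 by decide]
  have hT : χ S * χ T ^ 3 = 1 := by
    linear_combination (χ S ^ 2) * hST + (1 - χ S * χ T ^ 3) * hS4
  have hT12 : χ T ^ 12 = 1 := by
    linear_combination (-χ T ^ 12) * hS4 + ((χ S * χ T ^ 3) ^ 3 + (χ S * χ T ^ 3) ^ 2 +
      χ S * χ T ^ 3 + 1) * hT
  refine MonoidHom.eq_of_eqOn_dense SpecialLinearGroup.SL2Z_generators ?_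
  rintro γ (rfl | rfl)
  · rw [MonoidHom.pow_apply, MonoidHom.one_apply]
    linear_combination (χ S ^ 8 + χ S ^ 4 + 1) * hS4
  · exact hT12

/-- The span over `qAlg` of the forms with character `χ` of all weights. -/
def charSpan (χ : SL(2, ℤ) →* ℂ) : Submodule qAlg (ℍ → ℂ) :=
  Submodule.span qAlg {g | ∃ k, IsCharForm χ k g}

lemma mul_mem_charSpan {χ₁ χ₂ : SL(2, ℤ) →* ℂ} {f₁ f₂ : ℍ → ℂ} (h₁ : f₁ ∈ charSpan χ₁)
    (h₂ : f₂ ∈ charSpan χ₂) : f₁ * f₂ ∈ charSpan (χ₁ * χ₂) := by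
  have hle : charSpan χ₁ * charSpan χ₂ ≤ charSpan (χ₁ * χ₂) := by
    rw [charSpan, charSpan, Submodule.span_mul_span, Submodule.span_le]
    rintro _ ⟨g₁, ⟨k₁, hg₁⟩, g₂, ⟨k₂, hg₂⟩, rfl⟩
    exact Submodule.subset_span ⟨k₁ + k₂, hg₁.mul hg₂⟩
  exact hle (Submodule.mul_mem_mul h₁ h₂)

lemma pow_succ_mem_charSpan {χ : SL(2, ℤ) →* ℂ} {f : ℍ → ℂ} (h : f ∈ charSpan χ) (n : ℕ) :
    f ^ (n + 1) ∈ charSpan (χ ^ (n + 1)) := by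
  induction n with
  | zero => simpa only [zero_add, pow_one] using h
  | succ n ih => simpa only [pow_succ _ (n + 1)] using mul_mem_charSpan ih h

lemma mem_qAlg_of_mem_charSpan_one {f : ℍ → ℂ} (h : f ∈ charSpan 1) : f ∈ qAlg := by
  induction h using Submodule.span_induction with
  | mem g hg => exact hg.choose_spec.mem_qAlg
  | zero => exact zero_mem _
  | add f g _ _ hf hg => exact add_mem hf hg
  | smul c f _ hf => exact mul_mem c.2 hf

end CharacterForms

section VectorValuedForms

variable {d : ℕ} {ρ : SL(2, ℤ) →* GL (Fin d) ℂ} {k : ℤ}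

/-- The holomorphic functions on the upper half-plane. -/
def holAlg : Subalgebra ℂ (ℍ → ℂ) where
  carrier := {f | MDiff f}
  mul_mem' hf hg := MDifferentiable.mul hf hg
  add_mem' hf hg := MDifferentiable.add hf hg
  algebraMap_mem' _ := mdifferentiable_const

lemma normalizedDeriv_sum_smul {ι : Type*} (s : Finset ι) (c : ι → ℂ) {f : ι → ℍ → ℂ}
    (hf : ∀ i, MDiff (f i)) : D (∑ i ∈ s, c i • f i) = ∑ i ∈ s, c i • D (f i) := by
  classical
  induction s using Finset.induction_on with
  | empty => exact normalizedDerivOfComplex_const 0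
  | insert i s hi ih =>
    have hs : ∑ i ∈ s, c i • f i ∈ holAlg := sum_mem fun i _ ↦ holAlg.smul_mem (hf i) _
    rw [Finset.sum_insert hi, Finset.sum_insert hi,
      normalizedDerivOfComplex_add _ _ ((hf i).const_smul _) hs,
      normalizedDerivOfComplex_smul _ _ (hf i), ih]

lemma IsVVMF.slash_eq_sum {F : ℍ → Fin d → ℂ} (hF : IsVVMF ρ k F) (γ : SL(2, ℤ)) (i : Fin d) :
    (fun τ ↦ F τ i) ∣[k] γ = ∑ j, (ρ γ : Matrix (Fin d) (Fin d) ℂ) i j • fun τ ↦ F τ j := by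
  rw [hF.slash]
  ext τ
  simp [Matrix.mulVec, dotProduct]

lemma IsVVMF.apply_smul {F : ℍ → Fin d → ℂ} (hF : IsVVMF ρ k F) (γ : SL(2, ℤ)) (τ : ℍ) :
    F (γ • τ) = denom γ τ ^ k • (ρ γ : Matrix (Fin d) (Fin d) ℂ).mulVec (F τ) := by
  ext i
  have := congrFun (hF.slash γ i) τ
  rw [ModularForm.SL_slash_apply] at this
  rw [Pi.smul_apply, smul_eq_mul, ← this, zpow_neg, mul_comm, mul_assoc,
    inv_mul_cancel₀ (zpow_ne_zero _ (denom_ne_zero _ _)), mul_one]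

lemma IsVVMF.serreDerivative {F : ℍ → Fin d → ℂ} (hF : IsVVMF ρ k F) :
    IsVVMF ρ (k + 2) fun τ i ↦ Derivative.serreDerivative k (fun z ↦ F z i) τ where
  holo i := serreDerivative_mdifferentiable _ (hF.holo i)
  growth := moderateGrowth_iff.mpr fun i ↦
    (serreDerivative_mem_moderateAlg k ⟨hF.holo i, moderateGrowth_iff.mp hF.growth i⟩).2
  slash γ i := by
    refine (serreDerivative_slash_equivariant (hF.holo i)).trans ?_
    rw [hF.slash_eq_sum]
    ext τ
    rw [serreDerivative_apply, normalizedDeriv_sum_smul _ _ hF.holo]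
    simp [serreDerivative_apply, Matrix.mulVec, dotProduct, mul_sub, Finset.mul_sum,
      mul_left_comm]

/-- The span over `qAlg` of the vector-valued modular forms for `ρ` of all weights, where a vector
is regarded as the family of its components. -/
def vecSpan (ρ : SL(2, ℤ) →* GL (Fin d) ℂ) : Submodule qAlg (Fin d → ℍ → ℂ) :=
  Submodule.span qAlg {x | ∃ k, IsVVMF ρ k (Function.swap x)}

lemma swap_mem_vecSpan {F : ℍ → Fin d → ℂ} (hF : F ∈ formModule ρ) :
    Function.swap F ∈ vecSpan ρ := by
  refine Submodule.iSup_induction _ (motive := fun F ↦ Function.swap F ∈ vecSpan ρ) hF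
    (fun k G hG ↦ Submodule.subset_span ⟨k, hG⟩) (zero_mem _) fun _ _ ↦ add_mem

lemma mdifferentiable_of_mem_vecSpan {x : Fin d → ℍ → ℂ} (hx : x ∈ vecSpan ρ) (i : Fin d) :
    MDiff (x i) := by
  induction hx using Submodule.span_induction with
  | mem x hx => exact hx.choose_spec.holo i
  | zero => exact mdifferentiable_const
  | add x y _ _ hx hy => exact hx.add hy
  | smul c x _ hx => exact c.2.1.mul hx

lemma normalizedDeriv_mem_vecSpan {x : Fin d → ℍ → ℂ} (hx : x ∈ vecSpan ρ) :
    (fun i ↦ D (x i)) ∈ vecSpan ρ := by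
  induction hx using Submodule.span_induction with
  | mem x hx =>
    obtain ⟨k, hk⟩ := hx
    let c : qAlg := ⟨(k * 12⁻¹ : ℂ) • EisensteinSeries.E2, qAlg.smul_mem E2_mem_qAlg _⟩
    have hD : (fun i ↦ D (x i)) = (fun i ↦ serreDerivative k (x i)) + c • x := by
      ext i τ
      exact (sub_add_cancel _ _).symm
    rw [hD]
    exact add_mem (Submodule.subset_span ⟨k + 2, hk.serreDerivative⟩)
      (Submodule.smul_mem _ c (Submodule.subset_span ⟨k, hk⟩))
  | zero =>
    convert! zero_mem (vecSpan ρ) using 1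
    exact funext fun _ ↦ normalizedDerivOfComplex_const 0
  | add x y hx hy hx' hy' =>
    convert! add_mem hx' hy' using 1
    ext1 i
    exact normalizedDerivOfComplex_add _ _ (mdifferentiable_of_mem_vecSpan hx i)
      (mdifferentiable_of_mem_vecSpan hy i)
  | smul c x hx hx' =>
    convert! add_mem (Submodule.smul_mem _ ⟨_, normalizedDeriv_mem_qAlg c.2⟩ hx)
      (Submodule.smul_mem _ c hx') using 1
    ext1 i
    exact normalizedDerivOfComplex_mul _ _ c.2.1 (mdifferentiable_of_mem_vecSpan hx i)

lemma iterate_normalizedDeriv_mem_vecSpan {x : Fin d → ℍ → ℂ} (hx : x ∈ vecSpan ρ) (n : ℕ) :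
    (fun i ↦ D^[n] (x i)) ∈ vecSpan ρ := by
  induction n with
  | zero => exact hx
  | succ n ih => simpa only [Function.iterate_succ_apply'] using normalizedDeriv_mem_vecSpan ih

end VectorValuedForms

section Determinants

open Matrix

lemma multilinearMap_mem_of_forall_mem_span {R ι M N : Type*} [Semiring R] [Finite ι]
    [AddCommMonoid M] [Module R M] [AddCommMonoid N] [Module R N]
    (f : MultilinearMap R (fun _ : ι ↦ M) N) {S : Set M} {P : Submodule R N}
    (h : ∀ x : ι → M, (∀ i, x i ∈ S) → f x ∈ P) {x : ι → M}
    (hx : ∀ i, x i ∈ Submodule.span R S) : f x ∈ P := by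
  classical
  have := Fintype.ofFinite ι
  suffices H : ∀ s : Finset ι, ∀ x : ι → M, (∀ i ∈ s, x i ∈ Submodule.span R S) →
      (∀ i ∉ s, x i ∈ S) → f x ∈ P from H Finset.univ x (fun i _ ↦ hx i) (by simp)
  intro s
  induction s using Finset.induction_on with
  | empty => exact fun x _ hx ↦ h x fun i ↦ hx i (Finset.notMem_empty i)
  | insert a s ha ih =>
    intro x hxs hxS
    have hle : Submodule.span R S ≤ P.comap (f.toLinearMap x a) := by
      refine Submodule.span_le.mpr fun y hy ↦ ih _ (fun i hi ↦ ?_) fun i hi ↦ ?_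
      · rw [Function.update_of_ne (ne_of_mem_of_not_mem hi ha)]
        exact hxs i (Finset.mem_insert_of_mem hi)
      · rcases eq_or_ne i a with rfl | hia
        · simpa using hy
        · rw [Function.update_of_ne hia]
          exact hxS i (by simp [hia, hi])
    simpa using hle (hxs a (Finset.mem_insert_self a s))

lemma det_mem_of_forall_mem {A ι S : Type*} [CommRing A] [Fintype ι] [DecidableEq ι]
    [SetLike S A] [SubringClass S A] (s : S) {M : Matrix ι ι A} (h : ∀ i j, M i j ∈ s) :
    M.det ∈ s := by
  let M' : Matrix ι ι s := of fun i j ↦ ⟨M i j, h i j⟩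
  have hM : (M'.det : A) = M.det := (SubringClass.subtype s).map_det M'
  exact hM ▸ M'.det.2

variable {d : ℕ} {ρ : SL(2, ℤ) →* GL (Fin d) ℂ}

/-- The determinant character of a representation. -/
def detChar (ρ : SL(2, ℤ) →* GL (Fin d) ℂ) : SL(2, ℤ) →* ℂ :=
  detMonoidHom.comp ((Units.coeHom _).comp ρ)

lemma isCharForm_det {k : Fin d → ℤ} {G : Fin d → Fin d → ℍ → ℂ}
    (hG : ∀ t, IsVVMF ρ (k t) (Function.swap (G t))) :
    IsCharForm (detChar ρ) (∑ t, k t) (of G).det where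
  mem := det_mem_of_forall_mem _ fun t i ↦
    ⟨(hG t).holo i, moderateGrowth_iff.mp (hG t).growth i⟩
  slash γ := by
    ext τ
    have hdet (z : ℍ) : (of G).det z = (of fun t ↦ Function.swap (G t) z).det :=
      RingHom.map_det (Pi.evalRingHom (fun _ ↦ ℂ) z) (of G)
    have hmat : (of fun t ↦ Function.swap (G t) (γ • τ)) =
        diagonal (fun t ↦ denom γ τ ^ k t) *
          ((of fun t ↦ Function.swap (G t) τ) * (ρ γ : Matrix (Fin d) (Fin d) ℂ)ᵀ) := by
      ext t i
      rw [diagonal_mul, of_apply, (hG t).apply_smul, mul_apply]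
      simp [mulVec, dotProduct, mul_comm]
    have hne := denom_ne_zero γ τ
    have hprod : ∏ t, denom γ τ ^ k t = denom γ τ ^ ∑ t, k t := by
      induction (Finset.univ : Finset (Fin d)) using Finset.induction_on with
      | empty => simp
      | insert t s ht ih => rw [Finset.prod_insert ht, Finset.sum_insert ht, zpow_add₀ hne, ih]
    rw [ModularForm.SL_slash_apply, hdet, hmat, det_mul, det_diagonal, det_mul, det_transpose,
      hprod, mul_comm, ← mul_assoc, ← zpow_add₀ hne, neg_add_cancel, zpow_zero, one_mul, mul_comm,
      Pi.smul_apply, hdet]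
    rfl

lemma det_mem_charSpan {X : Fin d → Fin d → ℍ → ℂ} (hX : ∀ t, X t ∈ vecSpan ρ) :
    (of X).det ∈ charSpan (detChar ρ) := by
  refine multilinearMap_mem_of_forall_mem_span
    ((detRowAlternating (n := Fin d) (R := ℍ → ℂ)).toMultilinearMap.restrictScalars qAlg)
    (fun G hG ↦ ?_) hX
  choose k hk using hG
  exact Submodule.subset_span ⟨_, isCharForm_det hk⟩

/-- Cramer's rule gives such a relation with coefficients in `charSpan (detChar ρ)`; multiplying it
by the eleventh power of the determinant makes the characters trivial. -/
lemma exists_relation {X : Fin d → Fin d → ℍ → ℂ} (hX : ∀ t, X t ∈ vecSpan ρ)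
    (hdet : (of X).det ≠ 0) {y : Fin d → ℍ → ℂ} (hy : y ∈ vecSpan ρ) :
    ∃ Q ∈ qAlg, Q ≠ 0 ∧ ∃ R : Fin d → ℍ → ℂ, (∀ t, R t ∈ qAlg) ∧
      ∀ i, Q * y i = ∑ t, R t * X t i := by
  set W := (of X).det
  let V (t : Fin d) : ℍ → ℂ := ((of X).updateRow t y).det
  have hW : W ∈ charSpan (detChar ρ) := det_mem_charSpan hX
  have hV (t : Fin d) : V t ∈ charSpan (detChar ρ) := by
    refine det_mem_charSpan (X := Function.update X t y) fun s ↦ ?_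
    rcases eq_or_ne s t with rfl | hs
    · simpa using hy
    · simpa [hs] using hX s
  have hmem {f : ℍ → ℂ} (hf : f ∈ charSpan (detChar ρ)) : W ^ 11 * f ∈ qAlg := by
    have := mul_mem_charSpan (pow_succ_mem_charSpan hW 10) hf
    rw [← pow_succ, character_pow_twelve] at this
    exact mem_qAlg_of_mem_charSpan_one this
  refine ⟨W ^ 11 * W, hmem hW, by simpa only [← pow_succ] using pow_ne_zero 12 hdet,
    fun t ↦ W ^ 11 * V t, fun t ↦ hmem (hV t), fun i ↦ ?_⟩
  have hcramer : ∑ t, X t i * V t = W * y i := by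
    simpa [mulVec, dotProduct, cramer_transpose_apply, det_transpose] using
      congrFun (mulVec_cramer (of X)ᵀ y) i
  rw [mul_assoc, ← hcramer, Finset.mul_sum]
  exact Finset.sum_congr rfl fun t _ ↦ by ring

end Determinants

section LinearIndependence

variable {d : ℕ} {ρ : SL(2, ℤ) →* GL (Fin d) ℂ} {F : ℍ → Fin d → ℂ}

lemma eq_zero_of_forall_dotProduct_mulVec_eq_zero (hirr : (toRepresentation ρ).IsIrreducible)
    {l : Fin d → ℂ} (hl : l ≠ 0) {v : Fin d → ℂ}
    (h : ∀ γ, l ⬝ᵥ (ρ γ : Matrix (Fin d) (Fin d) ℂ).mulVec v = 0) : v = 0 := by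
  let W : Subrepresentation (toRepresentation ρ) :=
    { toSubmodule :=
        { carrier := {w | ∀ γ, l ⬝ᵥ (ρ γ : Matrix (Fin d) (Fin d) ℂ).mulVec w = 0}
          zero_mem' := fun γ ↦ by simp
          add_mem' := fun hv hw γ ↦ by rw [Matrix.mulVec_add, dotProduct_add, hv γ, hw γ, add_zero]
          smul_mem' := fun c w hw γ ↦ by
            rw [Matrix.mulVec_smul, dotProduct_smul, hw γ, smul_zero] }
      apply_mem_toSubmodule := fun g w hw γ ↦ by
        have := hw (γ * g)
        rwa [map_mul, Units.val_mul, ← Matrix.mulVec_mulVec] at this }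
  have hv : v ∈ W.toSubmodule := h
  rcases hirr.eq_bot_or_eq_top W with hW | hW
  · rw [hW] at hv
    exact (Submodule.mem_bot ℂ).mp hv
  · refine absurd (dotProduct_eq_zero l fun w ↦ ?_) hl
    have hw : w ∈ W.toSubmodule := hW ▸ Submodule.mem_top
    simpa using hw 1

lemma IsVVMF.eq_zero_of_dotProduct_eq_zero (hirr : (toRepresentation ρ).IsIrreducible) {k : ℤ}
    (hF : IsVVMF ρ k F) {l : Fin d → ℂ} (hl : l ≠ 0) (h : ∀ τ, l ⬝ᵥ F τ = 0) : F = 0 := by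
  refine funext fun τ ↦ eq_zero_of_forall_dotProduct_mulVec_eq_zero hirr hl fun γ ↦ ?_
  have := h (γ • τ)
  rw [hF.apply_smul, dotProduct_smul, smul_eq_mul] at this
  exact (mul_eq_zero.mp this).resolve_left (zpow_ne_zero _ (denom_ne_zero _ _))

lemma eq_zero_of_sum_zpow_mul_eq_zero {K : Type*} [Field K] {s : Finset ℤ} {v : ℤ → K} {Z : Set K}
    (hZ : Z.Infinite) (hZ₀ : 0 ∉ Z) (h : ∀ z ∈ Z, ∑ k ∈ s, z ^ k * v k = 0) {k : ℤ} (hk : k ∈ s) :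
    v k = 0 := by
  obtain ⟨m, hm⟩ := s.bddBelow
  have hexp {j : ℤ} (hj : j ∈ s) : (((j - m).toNat : ℕ) : ℤ) = j - m :=
    Int.toNat_of_nonneg (sub_nonneg.mpr (hm hj))
  let P : Polynomial K := ∑ j ∈ s, Polynomial.monomial (j - m).toNat (v j)
  have hroot : ∀ z ∈ Z, P.IsRoot z := by
    intro z hz
    have hz₀ : z ≠ 0 := fun h₀ ↦ hZ₀ (h₀ ▸ hz)
    calc P.eval z = ∑ j ∈ s, z ^ (-m) * (z ^ j * v j) := by
          rw [Polynomial.eval_finsetSum]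
          refine Finset.sum_congr rfl fun j hj ↦ ?_
          rw [Polynomial.eval_monomial, ← zpow_natCast, hexp hj, sub_eq_neg_add, zpow_add₀ hz₀]
          ring
      _ = 0 := by rw [← Finset.mul_sum, h z hz, mul_zero]
  have hP : P = 0 := P.eq_zero_of_infinite_isRoot (hZ.mono hroot)
  calc v k = P.coeff (k - m).toNat := by
        rw [Polynomial.finsetSum_coeff, Finset.sum_eq_single_of_mem k hk,
          Polynomial.coeff_monomial_same]
        intro j hj hjk
        refine Polynomial.coeff_monomial_of_ne _ fun hjk' ↦ hjk ?_
        have := hexp hj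
        have := hexp hk
        lia
    _ = 0 := by rw [hP, Polynomial.coeff_zero]

lemma IsVVMF.apply_natCast_vadd {N : ℕ} (hT : ρ ModularGroup.T ^ N = 1) {k : ℤ}
    (hF : IsVVMF ρ k F) (n : ℕ) (τ : ℍ) : F (((N * n : ℕ) : ℝ) +ᵥ τ) = F τ := by
  have hρ : ρ (ModularGroup.T ^ (N * n)) = 1 := by rw [map_pow, pow_mul, hT, one_pow]
  have hdenom : denom (ModularGroup.T ^ (N * n) : SL(2, ℤ)) τ = 1 := by
    rw [← zpow_natCast, ModularGroup.denom_apply, ModularGroup.coe_T_zpow]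
    simp
  have hsmul := modular_T_zpow_smul τ ((N * n : ℕ) : ℤ)
  rw [zpow_natCast, Int.cast_natCast] at hsmul
  rw [← hsmul, hF.apply_smul, hρ, hdenom]
  simp

lemma dotProduct_eq_zero_of_dotProduct_sum_eq_zero {N : ℕ} (hN : 0 < N)
    (hT : ρ ModularGroup.T ^ N = 1) {s : Finset ℤ} {G : ℤ → ℍ → Fin d → ℂ}
    (hG : ∀ k, IsVVMF ρ k (G k)) {l : Fin d → ℂ} (h : ∀ τ, l ⬝ᵥ ∑ k ∈ s, G k τ = 0) {k : ℤ}
    (hk : k ∈ s) (τ : ℍ) : l ⬝ᵥ G k τ = 0 := by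
  suffices hS : ∀ τ, l ⬝ᵥ (ρ ModularGroup.S : Matrix (Fin d) (Fin d) ℂ).mulVec (G k τ) = 0 by
    have := (hG k).apply_smul ModularGroup.S (ModularGroup.S⁻¹ • τ)
    rw [smul_inv_smul] at this
    rw [this, dotProduct_smul, hS, smul_zero]
  intro τ
  -- `G k (-1/z) = z ^ k ρ(S) G k (z)` and `G k` is `N`-periodic: evaluate at `-1/(τ + N n)`.
  refine eq_zero_of_sum_zpow_mul_eq_zero (s := s)
    (v := fun k ↦ l ⬝ᵥ (ρ ModularGroup.S : Matrix (Fin d) (Fin d) ℂ).mulVec (G k τ))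
    (Z := Set.range fun n : ℕ ↦ (((((N * n : ℕ) : ℝ) +ᵥ τ) : ℍ) : ℂ))
    (Set.infinite_range_of_injective fun m n hmn ↦ ?_) ?_ ?_ hk
  · exact Nat.eq_of_mul_eq_mul_left hN (by simpa [hN.ne'] using hmn)
  · rintro ⟨n, hn⟩
    exact ne_zero _ hn
  · rintro _ ⟨n, rfl⟩
    have := h (ModularGroup.S • (((N * n : ℕ) : ℝ) +ᵥ τ))
    simpa only [dotProduct_sum, (hG _).apply_smul, (hG _).apply_natCast_vadd hT, dotProduct_smul,
      smul_eq_mul, ModularGroup.denom_S] using this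

lemma linearIndependent_swap_of_mem_formModule (hirr : (toRepresentation ρ).IsIrreducible) {N : ℕ}
    (hN : 0 < N) (hT : ρ ModularGroup.T ^ N = 1) (hF : F ∈ formModule ρ) (hF₀ : F ≠ 0) :
    LinearIndependent ℂ (Function.swap F) := by
  refine Fintype.linearIndependent_iff.mpr fun l hl ↦ congrFun (by_contra fun hl₀ ↦ hF₀ ?_)
  obtain ⟨G, hG, rfl⟩ := (Submodule.mem_iSup_iff_exists_finsupp _ _).mp hF
  refine Finset.sum_eq_zero fun k hk ↦ (hG k).eq_zero_of_dotProduct_eq_zero hirr hl₀ fun τ ↦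
    dotProduct_eq_zero_of_dotProduct_sum_eq_zero hN hT hG (fun τ ↦ ?_) hk τ
  simpa [dotProduct, Finsupp.sum, Function.swap] using congrFun hl τ

end LinearIndependence

section Wronskian

lemma iterate_normalizedDeriv_apply (f : ℍ → ℂ) (n : ℕ) (τ : ℍ) :
    D^[n] f τ = (2 * Real.pi * Complex.I)⁻¹ ^ n * iteratedDeriv n (f ∘ ofComplex) τ := by
  induction n generalizing τ with
  | zero => simp
  | succ n ih =>
    rw [Function.iterate_succ_apply', normalizedDerivOfComplex, iteratedDeriv_succ, pow_succ',
      mul_assoc (2 * Real.pi * Complex.I)⁻¹,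
      ← deriv_const_mul_field ((2 * Real.pi * Complex.I)⁻¹ ^ n)]
    refine congrArg _ (Filter.EventuallyEq.deriv_eq ?_)
    filter_upwards [isOpen_upperHalfPlaneSet.mem_nhds τ.im_pos] with z hz
    rw [Function.comp_apply, ofComplex_apply_of_im_pos hz, ih]

lemma eq_zero_of_iterate_normalizedDeriv_eq_zero {f : ℍ → ℂ} (hf : MDiff f) {τ₀ : ℍ}
    (h : ∀ n, D^[n] f τ₀ = 0) : f = 0 := by
  have han : AnalyticOnNhd ℂ (f ∘ ofComplex) {z | 0 < z.im} :=
    (UpperHalfPlane.mdifferentiable_iff.mp hf).analyticOnNhd isOpen_upperHalfPlaneSet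
  have hderiv (n : ℕ) : iteratedDeriv n (f ∘ ofComplex) τ₀ = 0 := by
    have := h n
    rw [iterate_normalizedDeriv_apply] at this
    exact (mul_eq_zero.mp this).resolve_left (pow_ne_zero _ (inv_ne_zero Complex.two_pi_I_ne_zero))
  have horder : analyticOrderAt (f ∘ ofComplex) τ₀ = ⊤ := ENat.eq_top_iff_forall_ge.mpr fun n ↦
    (natCast_le_analyticOrderAt_iff_iteratedDeriv_eq_zero (han _ τ₀.im_pos)).mpr fun i _ ↦ hderiv i
  have hzero := han.eqOn_zero_of_preconnected_of_eventuallyEq_zero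
    (convex_halfSpace_im_gt 0).isPreconnected τ₀.im_pos (analyticOrderAt_eq_top.mp horder)
  ext τ
  simpa using hzero τ.im_pos

lemma iterate_normalizedDeriv_sum_smul {ι : Type*} (s : Finset ι) (c : ι → ℂ) {f : ι → ℍ → ℂ}
    (hf : ∀ i, MDiff (f i)) (n : ℕ) :
    D^[n] (∑ i ∈ s, c i • f i) = ∑ i ∈ s, c i • D^[n] (f i) := by
  have hmaps : Set.MapsTo D {f | MDiff f} {f | MDiff f} :=
    fun _ ↦ normalizedDerivOfComplex_mdifferentiable
  induction n with
  | zero => rfl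
  | succ n ih =>
    simp only [Function.iterate_succ_apply', ih]
    exact normalizedDeriv_sum_smul s c fun i ↦ hmaps.iterate n (hf i)

lemma exists_det_ne_zero_of_span_range_eq_top {K ι κ : Type*} [Field K] [Fintype ι] [DecidableEq ι]
    {v : κ → ι → K} (hv : Submodule.span K (Set.range v) = ⊤) :
    ∃ r : ι → κ, (Matrix.of fun t ↦ v (r t)).det ≠ 0 := by
  obtain ⟨κ', a, -, hspan, hli⟩ := exists_linearIndependent' K v
  let e : ι ≃ κ' := (Pi.basisFun K ι).indexEquiv (.mk hli (hspan.trans hv).ge)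
  have hrows : LinearIndependent K (Matrix.of fun t ↦ v (a (e t))).row :=
    hli.comp e e.injective
  exact ⟨a ∘ e, ((Matrix.isUnit_iff_isUnit_det _).mp
    (Matrix.linearIndependent_rows_iff_isUnit.mp hrows)).ne_zero⟩

lemma exists_det_iterate_normalizedDeriv_ne_zero {ι : Type*} [Fintype ι] [DecidableEq ι]
    {x : ι → ℍ → ℂ} (hx : ∀ i, MDiff (x i)) (hli : LinearIndependent ℂ x) (τ₀ : ℍ) :
    ∃ r : ι → ℕ, (Matrix.of fun t i ↦ D^[r t] (x i) τ₀).det ≠ 0 := by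
  refine exists_det_ne_zero_of_span_range_eq_top (v := fun n i ↦ D^[n] (x i) τ₀) ?_
  by_contra hne
  obtain ⟨φ, hφ₀, hφ⟩ := Submodule.exists_le_ker_of_lt_top _ (lt_top_iff_ne_top.mpr hne)
  obtain ⟨l, rfl⟩ := (dotProductEquiv ℂ ι).surjective φ
  have hsum : ∑ i, l i • x i = 0 := by
    have hmem : ∑ i, l i • x i ∈ holAlg := sum_mem fun i _ ↦ holAlg.smul_mem (hx i) _
    refine eq_zero_of_iterate_normalizedDeriv_eq_zero (τ₀ := τ₀) hmem fun n ↦ ?_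
    have hn : l ⬝ᵥ (fun i ↦ D^[n] (x i) τ₀) = 0 := hφ (Submodule.subset_span ⟨n, rfl⟩)
    rw [iterate_normalizedDeriv_sum_smul _ _ hx]
    simpa [dotProduct] using hn
  have hl : l = 0 := funext (Fintype.linearIndependent_iff.mp hli l hsum)
  exact hφ₀ (by rw [hl, map_zero])

end Wronskian

section BoundedCoefficients

variable {K : Type*} [NormedField K]

/-- The power series with bounded coefficients: for `K = ℚ_[p]`, those in whose coefficients the
power of `p` in the denominators is bounded. -/
def HasBoundedCoeff (P : K⟦X⟧) : Prop := ∃ C, ∀ n, ‖P.coeff n‖ ≤ C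

lemma HasBoundedCoeff.of_X_pow_mul {P : K⟦X⟧} {k : ℕ} (h : HasBoundedCoeff (X ^ k * P)) :
    HasBoundedCoeff P :=
  h.imp fun _ hC n ↦ by simpa only [coeff_X_pow_mul] using hC (n + k)

variable [IsUltrametricDist K]

lemma HasBoundedCoeff.add {P Q : K⟦X⟧} (hP : HasBoundedCoeff P) (hQ : HasBoundedCoeff Q) :
    HasBoundedCoeff (P + Q) := by
  obtain ⟨C, hC⟩ := hP
  obtain ⟨B, hB⟩ := hQ
  exact ⟨max C B, fun n ↦ by
    simpa only [map_add] using (IsUltrametricDist.norm_add_le_max _ _).trans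
      (max_le_max (hC n) (hB n))⟩

lemma norm_coeff_mul_mk_eq {P : K⟦X⟧} {a : ℕ → K} {C : ℝ} (hC : ∀ n, ‖P.coeff n‖ ≤ C) {m : ℕ}
    (h : ∀ j < m, C * ‖a j‖ < ‖P.constantCoeff‖ * ‖a m‖) :
    ‖(P * PowerSeries.mk a).coeff m‖ = ‖P.constantCoeff‖ * ‖a m‖ := by
  rw [coeff_mul, IsUltrametricDist.isNonarchimedean_norm.apply_sum_eq_of_lt
    (fun x ↦ (norm_neg x).symm) (k := (0, m)) (by simp)]
  · simp
  · rintro ⟨i, j⟩ hij hne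
    obtain rfl : i + j = m := by simpa using hij
    have hi : i ≠ 0 := fun hi ↦ hne (by simp [hi])
    simp only [coeff_mk, norm_mul, coeff_zero_eq_constantCoeff]
    exact (mul_le_mul_of_nonneg_right (hC i) (norm_nonneg _)).trans_lt (h j (by lia))

lemma not_hasBoundedCoeff_mul_mk {a : ℕ → K} (ha₀ : a 0 ≠ 0)
    (ha : ∀ ε > 0, ∃ m > 0, ∀ j < m, ‖a j‖ < ε * ‖a m‖) {P : K⟦X⟧} (hP : HasBoundedCoeff P)
    (hP₀ : P ≠ 0) : ¬ HasBoundedCoeff (P * PowerSeries.mk a) := by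
  suffices H : ∀ P : K⟦X⟧, HasBoundedCoeff P → P.constantCoeff ≠ 0 →
      ¬ HasBoundedCoeff (P * PowerSeries.mk a) by
    rw [← X_pow_order_mul_divXPowOrder (f := P)] at hP ⊢
    rw [mul_assoc]
    exact fun h ↦ H _ hP.of_X_pow_mul (constantCoeff_divXPowOrder_eq_zero_iff.not.mpr hP₀)
      h.of_X_pow_mul
  rintro P ⟨C, hC⟩ hP₀ ⟨B, hB⟩
  have ha₀' : 0 < ‖a 0‖ := norm_pos_iff.mpr ha₀
  have hP₀' : 0 < ‖P.constantCoeff‖ := norm_pos_iff.mpr hP₀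
  let M := max C (B / ‖a 0‖)
  have hM (n : ℕ) : ‖P.coeff n‖ ≤ M := (hC n).trans (le_max_left _ _)
  have hM₀ : 0 < M := hP₀'.trans_le (by simpa using hM 0)
  obtain ⟨m, hm, hlt⟩ := ha (‖P.constantCoeff‖ / M) (div_pos hP₀' hM₀)
  have hlt' (j : ℕ) (hj : j < m) : M * ‖a j‖ < ‖P.constantCoeff‖ * ‖a m‖ := by
    have := hlt j hj
    rwa [div_mul_eq_mul_div, lt_div_iff₀ hM₀, mul_comm] at this
  have hlarge : B < ‖(P * PowerSeries.mk a).coeff m‖ :=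
    calc B ≤ M * ‖a 0‖ := (div_le_iff₀ ha₀').mp (le_max_right _ _)
      _ < ‖P.constantCoeff‖ * ‖a m‖ := hlt' 0 hm
      _ = ‖(P * PowerSeries.mk a).coeff m‖ := (norm_coeff_mul_mk_eq hM hlt').symm
  exact (hB m).not_gt hlarge

lemma exists_forall_norm_lt_of_norm_le_norm_succ_mul {p : ℕ} (hp₀ : (p : K) ≠ 0)
    (hp₁ : ‖(p : K)‖ < 1) {a : ℕ → K} (ha₀ : a 0 ≠ 0)
    (ha : ∀ n, ‖a n‖ ≤ ‖((n + 1 : ℕ) : K) * a (n + 1)‖) {ε : ℝ} (hε : 0 < ε) :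
    ∃ m > 0, ∀ j < m, ‖a j‖ < ε * ‖a m‖ := by
  have hmono : Monotone fun n ↦ ‖a n‖ := monotone_nat_of_le_succ fun n ↦ (ha n).trans <| by
    rw [norm_mul]
    exact mul_le_of_le_one_left (norm_nonneg _) (IsUltrametricDist.norm_natCast_le_one K _)
  obtain ⟨t, ht⟩ := exists_pow_lt_of_lt_one hε hp₁
  have hpt : p ^ t ≠ 0 := pow_ne_zero t (by rintro rfl; simp at hp₀)
  obtain ⟨m, hm⟩ := Nat.exists_eq_succ_of_ne_zero hpt
  refine ⟨m + 1, m.succ_pos, fun j hj ↦ ?_⟩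
  have hpos : 0 < ‖a (m + 1)‖ := (norm_pos_iff.mpr ha₀).trans_le (hmono (Nat.zero_le _))
  calc ‖a j‖ ≤ ‖a m‖ := hmono (Nat.lt_succ_iff.mp hj)
    _ ≤ ‖((m + 1 : ℕ) : K) * a (m + 1)‖ := ha m
    _ = ‖(p : K)‖ ^ t * ‖a (m + 1)‖ := by
      rw [norm_mul, ← Nat.succ_eq_add_one, ← hm, Nat.cast_pow, norm_pow]
    _ < ε * ‖a (m + 1)‖ := by gcongr

lemma exists_forall_norm_le_of_fg {M A ι : Type*} [AddCommGroup M] [SeminormedAddCommGroup A]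
    [IsUltrametricDist A] (f : ι → M →+ A) (hf : ∀ x, ∃ C, ∀ i, ‖f i x‖ ≤ C) {L : Submodule ℤ M}
    (hL : L.FG) : ∃ C, ∀ x ∈ L, ∀ i, ‖f i x‖ ≤ C := by
  induction L, hL using Submodule.fg_induction with
  | singleton x =>
    refine (hf x).imp fun C hC y hy i ↦ ?_
    obtain ⟨k, rfl⟩ := Submodule.mem_span_singleton.mp hy
    rw [map_zsmul]
    exact (IsUltrametricDist.norm_zsmul_le _ _).trans (hC i)
  | sup L₁ L₂ _ _ h₁ h₂ =>
    obtain ⟨C₁, h₁⟩ := h₁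
    obtain ⟨C₂, h₂⟩ := h₂
    refine ⟨max C₁ C₂, fun x hx i ↦ ?_⟩
    obtain ⟨y, hy, z, hz, rfl⟩ := Submodule.mem_sup.mp hx
    rw [map_add]
    exact (IsUltrametricDist.norm_add_le_max _ _).trans (max_le_max (h₁ y hy i) (h₂ z hz i))

end BoundedCoefficients

section WeaklyBounded

variable {E K : Type*} [CommRing E] [Algebra ℚ E] [NormedField K] [Algebra ℚ K]

lemma mk_linearMap_coeff_mul_map (φ : E →ₗ[ℚ] K) (P : E⟦X⟧) (Q : ℚ⟦X⟧) :
    (PowerSeries.mk fun n ↦ φ ((P * Q.map (algebraMap ℚ E)).coeff n)) =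
      (PowerSeries.mk fun n ↦ φ (P.coeff n)) * Q.map (algebraMap ℚ K) := by
  ext n
  simp only [coeff_mk, coeff_mul, coeff_map, map_sum]
  refine Finset.sum_congr rfl fun i _ ↦ ?_
  rw [mul_comm, ← Algebra.smul_def, map_smul, Algebra.smul_def, mul_comm]

lemma exists_linearMap_apply_ne_zero {c : E} (hc : c ≠ 0) : ∃ φ : E →ₗ[ℚ] K, φ c ≠ 0 := by
  obtain ⟨ψ, hψ⟩ := not_forall.mp ((Module.forall_dual_apply_eq_zero_iff ℚ c).not.mpr hc)
  exact ⟨Algebra.linearMap ℚ K ∘ₗ ψ, (map_ne_zero (algebraMap ℚ K)).mpr hψ⟩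

variable [IsUltrametricDist K]

variable (E K) in
/-- The power series over `E` that every `ℚ`-linear map `E → K` sends to a series with bounded
coefficients. It extends `p`-adic boundedness to coefficients which need not be rational. -/
def weaklyBounded : Submodule E E⟦X⟧ where
  carrier := {P | ∀ φ : E →ₗ[ℚ] K, HasBoundedCoeff (PowerSeries.mk fun n ↦ φ (P.coeff n))}
  add_mem' {P Q} hP hQ φ := by
    convert! (hP φ).add (hQ φ) using 1
    ext n
    simp
  zero_mem' φ := ⟨0, fun n ↦ by simp⟩
  smul_mem' c P hP φ := by simpa using! hP (φ ∘ₗ LinearMap.mulLeft ℚ c)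

lemma mul_mem_weaklyBounded {P Q : E⟦X⟧} (hP : P ∈ fgCoeffSeries E) (hQ : Q ∈ weaklyBounded E K) :
    P * Q ∈ weaklyBounded E K := by
  intro φ
  obtain ⟨L, hL, hP⟩ := hP
  obtain ⟨C, hC⟩ := exists_forall_norm_le_of_fg
    (fun n ↦ (φ ∘ₗ LinearMap.mulRight ℚ (Q.coeff n)).toAddMonoidHom)
    (fun c ↦ by simpa [HasBoundedCoeff] using! hQ (φ ∘ₗ LinearMap.mulLeft ℚ c)) hL
  refine ⟨C, fun n ↦ ?_⟩
  rw [coeff_mk, coeff_mul, map_sum]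
  exact IsUltrametricDist.norm_sum_le_of_forall_le_of_nonneg
    ((norm_nonneg _).trans (hC 0 L.zero_mem 0)) fun i _ ↦ hC _ (hP i.1) i.2

lemma map_mem_weaklyBounded {P : ℚ⟦X⟧} (hP : HasBoundedCoeff (P.map (algebraMap ℚ K))) :
    P.map (algebraMap ℚ E) ∈ weaklyBounded E K := by
  intro φ
  obtain ⟨C, hC⟩ := hP
  refine ⟨C * ‖φ 1‖, fun n ↦ ?_⟩
  rw [coeff_mk, coeff_map, Algebra.algebraMap_eq_smul_one, map_smul, Algebra.smul_def, norm_mul,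
    ← coeff_map]
  gcongr
  exact hC n

lemma fgCoeffSeries_subset_weaklyBounded : (fgCoeffSeries E : Set E⟦X⟧) ⊆ weaklyBounded E K :=
  fun P hP ↦ by
    have h₁ : (1 : ℚ⟦X⟧).map (algebraMap ℚ E) ∈ weaklyBounded E K :=
      map_mem_weaklyBounded ⟨1, fun n ↦ by
        rw [map_one, coeff_one]
        split_ifs <;> simp⟩
    simpa using mul_mem_weaklyBounded hP h₁

lemma mul_map_notMem_weaklyBounded {p : ℕ} (hp₀ : (p : K) ≠ 0) (hp₁ : ‖(p : K)‖ < 1) {a : ℕ → ℚ}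
    (ha₀ : a 0 ≠ 0)
    (ha : ∀ n, ‖algebraMap ℚ K (a n)‖ ≤ ‖((n + 1 : ℕ) : K) * algebraMap ℚ K (a (n + 1))‖)
    {P : E⟦X⟧} (hP : P ∈ fgCoeffSeries E) (hP₀ : P ≠ 0) :
    P * (PowerSeries.mk a).map (algebraMap ℚ E) ∉ weaklyBounded E K := by
  intro h
  obtain ⟨n, hn⟩ := exists_coeff_ne_zero_iff_ne_zero.mpr hP₀
  obtain ⟨φ, hφ⟩ := exists_linearMap_apply_ne_zero (K := K) hn
  have ha₀' : algebraMap ℚ K (a 0) ≠ 0 := (map_ne_zero _).mpr ha₀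
  refine not_hasBoundedCoeff_mul_mk ha₀'
    (fun ε ↦ exists_forall_norm_lt_of_norm_le_norm_succ_mul hp₀ hp₁ ha₀' ha)
    (fgCoeffSeries_subset_weaklyBounded hP φ) (fun h₀ ↦ hφ ?_) ?_
  · simpa using congrArg (coeff n) h₀
  · have := h φ
    rw [mk_linearMap_coeff_mul_map] at this
    convert! this using 2

lemma twistedEuler_mem_weaklyBounded (r : ℝ) {P : ℂ⟦X⟧} (hP : P ∈ weaklyBounded ℂ K) :
    twistedEuler r P ∈ weaklyBounded ℂ K := by
  have hEuler : twistedEuler r P = (r : ℂ) • P + PowerSeries.mk fun n ↦ n * P.coeff n := by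
    ext n
    simp [add_mul]
  rw [hEuler]
  refine add_mem (Submodule.smul_mem _ _ hP) fun φ ↦ (hP φ).imp fun C hC n ↦ ?_
  rw [coeff_mk, coeff_mk, ← nsmul_eq_mul, map_nsmul]
  simpa using (IsUltrametricDist.norm_nsmul_le _ _).trans (hC n)

lemma iterate_twistedEuler_mem_weaklyBounded (r : ℝ) {P : ℂ⟦X⟧} (hP : P ∈ weaklyBounded ℂ K)
    (n : ℕ) : (twistedEuler r)^[n] P ∈ weaklyBounded ℂ K :=
  Set.MapsTo.iterate (fun _ ↦ twistedEuler_mem_weaklyBounded r) n hP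

end WeaklyBounded

section UnboundedDenominators

variable {d : ℕ} {ρ : SL(2, ℤ) →* GL (Fin d) ℂ}

lemma HasQSeries.iterate_normalizedDeriv {r : ℝ} {f : ℍ → ℂ} {P : ℂ⟦X⟧}
    (hf : HasQSeries r f (P.coeff ·)) (n : ℕ) :
    HasQSeries r (D^[n] f) (((twistedEuler r)^[n] P).coeff ·) := by
  induction n with
  | zero => exact hf
  | succ n ih => simpa only [Function.iterate_succ_apply'] using ih.normalizedDeriv

lemma exists_mul_mem_weaklyBounded {K : Type*} [NormedField K] [IsUltrametricDist K] [Algebra ℚ K]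
    (hirr : (toRepresentation ρ).IsIrreducible) {N : ℕ} (hN : 0 < N)
    (hT : ρ ModularGroup.T ^ N = 1) {F G : ℍ → Fin d → ℂ} (hF : F ∈ formModule ρ) (hF₀ : F ≠ 0)
    (hG : G ∈ formModule ρ) {i : Fin d} {r : ℝ} {P B : ℂ⟦X⟧}
    (hP : HasQSeries r (G · i) (P.coeff ·)) (hB : HasQSeries r (F · i) (B.coeff ·))
    (hBK : B ∈ weaklyBounded ℂ K) :
    ∃ Q ∈ fgCoeffSeries ℂ, Q ≠ 0 ∧ Q * P ∈ weaklyBounded ℂ K := by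
  have hFspan := swap_mem_vecSpan hF
  obtain ⟨n, hdet⟩ := exists_det_iterate_normalizedDeriv_ne_zero
    (mdifferentiable_of_mem_vecSpan hFspan)
    (linearIndependent_swap_of_mem_formModule hirr hN hT hF hF₀) I
  have hdet' : (Matrix.of fun t i ↦ D^[n t] (Function.swap F i)).det ≠ 0 := fun h ↦ hdet <|
    (RingHom.map_det (Pi.evalRingHom (fun _ ↦ ℂ) I) _).symm.trans (congrFun h I)
  obtain ⟨q, ⟨-, Q, hQ, hqQ⟩, hq₀, R, hR, hrel⟩ := exists_relation
    (fun t ↦ iterate_normalizedDeriv_mem_vecSpan hFspan (n t)) hdet' (swap_mem_vecSpan hG)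
  choose _ S hS hRS using hR
  refine ⟨Q, hQ, ?_, ?_⟩
  · rintro rfl
    exact hq₀ (funext fun τ ↦ (hqQ τ).unique (by simp))
  · have hleft : HasQSeries r (q * (G · i)) ((Q * P).coeff ·) := by
      simpa only [zero_add] using hqQ.mul hP
    have hright : HasQSeries r (∑ t, R t * D^[n t] (F · i))
        ((∑ t, S t * (twistedEuler r)^[n t] B).coeff ·) := .sum fun t _ ↦ by
      simpa only [zero_add] using (hRS t).mul (hB.iterate_normalizedDeriv (n t))
    have hrel_i : q * (G · i) = ∑ t, R t * D^[n t] (F · i) := hrel i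
    rw [hrel_i] at hleft
    rw [hleft.unique hright]
    exact sum_mem fun t _ ↦
      mul_mem_weaklyBounded (hS t) (iterate_twistedEuler_mem_weaklyBounded r hBK (n t))

lemma hasBoundedCoeff_map_of_forall_not_dvd_den {p : ℕ} [Fact p.Prime] {P : ℚ⟦X⟧} {m : ℕ}
    (h : ∀ n, ¬ p ^ m ∣ (P.coeff n).den) : HasBoundedCoeff (P.map (algebraMap ℚ ℚ_[p])) := by
  refine ⟨((p : ℚ) ^ m : ℚ), fun n ↦ ?_⟩
  rw [coeff_map, eq_ratCast, Padic.eq_padicNorm, Rat.cast_le]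
  rcases eq_or_ne (P.coeff n) 0 with h₀ | h₀
  · rw [h₀, padicNorm.zero]
    positivity
  have hden : padicValNat p (P.coeff n).den < m := by
    by_contra! hm
    exact h n ((pow_dvd_pow p hm).trans pow_padicValNat_dvd)
  rw [padicNorm.eq_zpow_of_nonzero h₀, ← zpow_natCast]
  refine zpow_le_zpow_right₀ (mod_cast (Fact.out : p.Prime).one_le) ?_
  rw [padicValRat]
  lia

lemma isPUBD_of_ne_zero (hirr : (toRepresentation ρ).IsIrreducible) {N : ℕ} (hN : 0 < N)
    (hT : ρ ModularGroup.T ^ N = 1) {r : Fin d → ℝ} {F₀ : ℍ → Fin d → ℂ} (hF₀ : F₀ ∈ formModule ρ)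
    {i : Fin d} {a : ℕ → ℚ} (ha₀ : a 0 ≠ 0) (ha : HasQSeries (r i) (F₀ · i) (a ·)) {p : ℕ}
    (hp : p.Prime) (hgrowth : ∀ n, padicNorm p (a n) ≤ padicNorm p ((n + 1 : ℕ) * a (n + 1)))
    {F : ℍ → Fin d → ℂ} (hF : F ∈ rationalForms ρ r) (hne : F ≠ 0) : IsPUBD p r F := by
  have := Fact.mk hp
  obtain ⟨hF, b, hb⟩ := hF
  by_contra hbdd
  obtain ⟨m, hm⟩ : ∃ m, ∀ n, ¬ p ^ m ∣ (b i n).den := by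
    by_contra! h
    exact hbdd ⟨b, hb, i, h⟩
  have hB : (PowerSeries.mk (b i)).map (algebraMap ℚ ℂ) ∈ weaklyBounded ℂ ℚ_[p] :=
    map_mem_weaklyBounded (hasBoundedCoeff_map_of_forall_not_dvd_den (m := m) (by simpa using hm))
  obtain ⟨Q, hQ, hQ₀, hmem⟩ := exists_mul_mem_weaklyBounded hirr hN hT hF hne hF₀
    (P := (PowerSeries.mk a).map (algebraMap ℚ ℂ)) (by simpa using ha) (by simpa using hb i) hB
  refine mul_map_notMem_weaklyBounded (mod_cast hp.ne_zero) Padic.norm_p_lt_one ha₀ (fun n ↦ ?_)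
    hQ hQ₀ hmem
  rw [eq_ratCast, eq_ratCast, ← Rat.cast_natCast, ← Rat.cast_mul, Padic.eq_padicNorm,
    Padic.eq_padicNorm, Rat.cast_le]
  exact hgrowth n

lemma zero_mem_pBoundedForms (ρ : SL(2, ℤ) →* GL (Fin d) ℂ) {p : ℕ} (hp : p.Prime)
    (r : Fin d → ℝ) : 0 ∈ pBoundedForms ρ p r := by
  refine ⟨⟨zero_mem _, 0, fun i τ ↦ by simp⟩, ?_⟩
  rintro ⟨a, ha, i, hi⟩
  obtain ⟨n, hn⟩ := hi 1
  have hzero : (PowerSeries.mk (a i)).map (algebraMap ℚ ℂ) = 0 :=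
    HasQSeries.eq_zero (r := r i) (by simpa using! ha i)
  have hcoeff : a i n = 0 := by simpa using congrArg (coeff n) hzero
  rw [hcoeff, Rat.den_zero, pow_one] at hn
  exact hp.one_lt.ne' (Nat.dvd_one.mp hn)

lemma lam_pos [NeZero d] {N : ℕ} {A : Fin d → ℕ} (hA : ∀ i, A i < N) {n : ℕ} (hn : 0 < n) :
    0 < lam N A n := by
  refine Finset.prod_pos fun i _ ↦ ?_
  have := hA i
  have := Nat.le_mul_of_pos_right N hn
  zify at *
  linarith [Int.natCast_nonneg (A 0)]

lemma padicNorm_le_padicNorm_succ_mul [NeZero d] {N : ℕ} {A : Fin d → ℕ} (hA : ∀ i, A i < N)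
    {p : ℕ} (hp : p.Prime) {a : ℕ → ℚ} (ha₀ : a 0 = 1) {δ : ℤ} (hδ : δ < 0)
    (hord : ∀ n : ℕ, 1 ≤ n → padicValRat p (a n) =
      n * δ - padicValInt p (∏ k ∈ Finset.Icc 1 n, (k : ℤ) * lam N A k)) (n : ℕ) :
    padicNorm p (a n) ≤ padicNorm p ((n + 1 : ℕ) * a (n + 1)) := by
  have := Fact.mk hp
  have hord' (n : ℕ) : padicValRat p (a n) =
      n * δ - padicValInt p (∏ k ∈ Finset.Icc 1 n, (k : ℤ) * lam N A k) := by
    rcases n.eq_zero_or_pos with rfl | hn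
    · simp [ha₀]
    · exact hord n hn
  have hfactor {k : ℕ} (hk : 0 < k) : (k : ℤ) * lam N A k ≠ 0 :=
    mul_ne_zero (mod_cast hk.ne') (lam_pos hA hk).ne'
  have hne (n : ℕ) : a n ≠ 0 := by
    rcases n.eq_zero_or_pos with rfl | hn
    · simp [ha₀]
    · intro h
      have hval := hord n hn
      have : (n : ℤ) * δ < 0 := mul_neg_of_pos_of_neg (mod_cast hn) hδ
      rw [h, padicValRat.zero] at hval
      lia
  have hn₁ : ((n + 1 : ℕ) : ℚ) ≠ 0 := mod_cast n.succ_ne_zero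
  have hval : padicValRat p ((n + 1 : ℕ) * a (n + 1)) ≤ padicValRat p (a n) := by
    rw [padicValRat.mul hn₁ (hne _), hord', hord', Finset.prod_Icc_succ_top (by lia),
      padicValInt.mul (Finset.prod_ne_zero_iff.mpr fun k hk ↦ hfactor (Finset.mem_Icc.mp hk).1)
        (hfactor n.succ_pos),
      padicValInt.mul (mod_cast n.succ_ne_zero) (lam_pos hA n.succ_pos).ne', padicValRat.of_nat,
      padicValInt.of_nat]
    push_cast
    linarith [(padicValInt p (lam N A (n + 1))).cast_nonneg (α := ℤ)]
  rw [padicNorm.eq_zpow_of_nonzero (hne n),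
    padicNorm.eq_zpow_of_nonzero (mul_ne_zero hn₁ (hne _))]
  exact zpow_le_zpow_right₀ (mod_cast hp.one_le) (neg_le_neg hval)

end UnboundedDenominators

end VVMF

end

theorem proposition4p3_general {d : ℕ} (ρ : SL(2, ℤ) →* GL (Fin d) ℂ)
    (hirr : (VVMF.toRepresentation ρ).IsIrreducible)
    (N : ℕ) (hN : 0 < N) (hT : ρ ModularGroup.T ^ N = 1) (r : Fin d → ℝ)
    (F₀ : ℍ → Fin d → ℂ) (hF₀ : F₀ ∈ VVMF.formModule ρ) (i : Fin d) (a : ℕ → ℚ) (ha₀ : a 0 ≠ 0)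
    (ha : VVMF.HasQSeries (r i) (fun τ ↦ F₀ τ i) (fun n ↦ (a n : ℂ))) (p : ℕ) (hp : p.Prime)
    (hgrowth : ∀ n : ℕ, padicNorm p (a n) ≤ padicNorm p ((n + 1 : ℕ) * a (n + 1))) :
    VVMF.pBoundedForms ρ p r = {0} ∧
      ∀ F ∈ VVMF.rationalForms ρ r, F ≠ 0 → VVMF.IsPUBD p r F := by
  have hPUBD : ∀ F ∈ VVMF.rationalForms ρ r, F ≠ 0 → VVMF.IsPUBD p r F := fun _ ↦
    VVMF.isPUBD_of_ne_zero hirr hN hT hF₀ ha₀ ha hp hgrowth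
  refine ⟨Set.eq_singleton_iff_unique_mem.mpr ⟨VVMF.zero_mem_pBoundedForms ρ hp r, ?_⟩, hPUBD⟩
  exact fun F hF ↦ by_contra fun hne ↦ hF.2 (hPUBD F hF.1 hne)

theorem proposition4p3 {d : ℕ} [NeZero d] (ρ : SL(2, ℤ) →* GL (Fin d) ℂ)
    (hirr : (VVMF.toRepresentation ρ).IsIrreducible)
    (N : ℕ) (hN : 0 < N) (hlevel : orderOf (ρ ModularGroup.T) = N)
    (A : Fin d → ℕ) (hA : ∀ i, A i < N)
    (hT : (ρ ModularGroup.T : Matrix (Fin d) (Fin d) ℂ) =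
      Matrix.diagonal fun i ↦ Complex.exp (2 * Real.pi * Complex.I * ((A i : ℂ) / N)))
    (k₀ : ℤ) (F₀ : ℍ → Fin d → ℂ) (hF₀ : F₀ ∈ VVMF.formSpace ρ k₀)
    (hcyc : VVMF.formModule ρ = VVMF.cyclicModule k₀ F₀)
    (a : ℕ → ℚ) (ha₀ : a 0 = 1)
    (ha : VVMF.HasQSeries ((A 0 : ℝ) / N) (fun τ ↦ F₀ τ 0) (fun n ↦ (a n : ℂ)))
    (p : ℕ) (hp : p.Prime) (δ : ℤ) (hδ : δ < 0)
    (hord : ∀ n : ℕ, 1 ≤ n →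
      padicValRat p (a n) =
        n * δ - padicValInt p (∏ k ∈ Finset.Icc 1 n, (k : ℤ) * VVMF.lam N A k)) :
    VVMF.pBoundedForms ρ p (fun i ↦ (A i : ℝ) / N) = {0} ∧
      ∀ F ∈ VVMF.rationalForms ρ (fun i ↦ (A i : ℝ) / N),
        F ≠ 0 → VVMF.IsPUBD p (fun i ↦ (A i : ℝ) / N) F := by
  exact proposition4p3_general ρ hirr N hN (hlevel ▸ pow_orderOf_eq_one _)
    (fun i ↦ (A i : ℝ) / N) F₀ (Submodule.mem_iSup_of_mem k₀ hF₀) 0 a (by simp [ha₀]) ha p hp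
    (VVMF.padicNorm_le_padicNorm_succ_mul hA hp ha₀ hδ hord)
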